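/- Graphs are simple, undirected, connected and locally finite, with countably many vertices, and $(X_n)$ is simple random walk, with law $\mathbb P_x$ when started from $x$. A random rooted graph $(G,o)$ is a random variable in the space of isomorphism classes of rooted graphs with the Borel $\sigma$-algebra of the local topology. It is reversible if $(G,o,X_1)$ and $(G,X_1,o)$ have the same law as random doubly rooted graphs, where, given $(G,o)$, $X_1$ is the first step of simple random walk from $o$. For a finite nonempty set $A$ of vertices with hitting time $T_A=\inf\{n\ge 0: X_n\in A\}$ let $$g_A(x,y)=\frac{1}{\deg y}\,\mathbb E_x\Big[\sum_{n=0}^{T_A-1}\mathbf 1_{\{X_n=y\}}\Big],\qquad a_A(x,y)=g_A(y,y)-g_A(x,y).$$ The potential kernel of $G$ is well defined if there is a function $a$ such that $a_{A_n}(x,y)\to a(x,y)$ for all vertices $x,y$ and every sequence $(A_n)$ of finite nonempty vertex sets whose graph distance from $o$ tends to infinity; then $a$ is the potential kernel. The random walk conditioned never to hit $o$ (CRW) is the Markov chain with transition probabilities $\hat p(x,y)=\frac{a(y,o)}{a(x,o)}\,\frac{1}{\deg x}$ for $x\neq o$ and $y\sim x$; if it starts at $o$, its first step goes to each neighbour $y$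 of $o$ with probability $a(y,o)$. It is defined from the starting points $x=o$ and $x$ with $a(x,o)>0$; call these admissible. **Proposition.** Let $(G,o)$ be a reversible random graph that a.s. is infinite, recurrent, and has a well-defined potential kernel. Then, for almost every $(G,o)$, the following holds for all admissible vertices $x,y$: if $\hat X$ and $\hat Y$ are two independent random walks conditioned never to hit $o$, started from $x$ and $y$ respectively, then $$\mathbb P\big(|\{\hat X_n:n\in\mathbb N\}\cap\{\hat Y_n:n\in\mathbb N\}|=\infty\big)=1 .$$ -/

import Mathlib

open MeasureTheory ProbabilityTheory Filter Topology
open scoped ENNReal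

noncomputable section

namespace ReversibleGraph

/-! ### Rooted graphs and the local topology -/

/-- A rooted graph: a connected, locally finite, simple undirected graph on a countable vertex set
with a distinguished vertex. -/
structure RootedGraph where
  V : Type
  G : SimpleGraph V
  o : V
  countable : Countable V
  connected : G.Connected
  locallyFinite : ∀ v, (G.neighborSet v).Finite

/-- A doubly rooted graph `(G, o, ρ)`. -/
structure BirootedGraph extends RootedGraph where
  ρ : V

instance (R : RootedGraph) : Countable R.V := R.countable

/-- All subsets of the (countable) vertex set are measurable. -/
instance (R : RootedGraph) : MeasurableSpace R.V := ⊤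

instance (R : RootedGraph) : DiscreteMeasurableSpace R.V := ⟨fun _ => trivial⟩

/-- The doubly rooted graph `(G, o, x)`. -/
def RootedGraph.withSecond (R : RootedGraph) (x : R.V) : BirootedGraph :=
  { R with ρ := x }

/-- The doubly rooted graph `(G, x, o)`. -/
def RootedGraph.withFirst (R : RootedGraph) (x : R.V) : BirootedGraph :=
  { R with o := x, ρ := R.o }

/-- The metric ball `B(o, r)` around the root. -/
def RootedGraph.ball (R : RootedGraph) (r : ℕ) : Set R.V := {v | R.G.dist R.o v ≤ r}

/-- Isomorphism of rooted graphs. -/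
instance RootedGraph.setoid : Setoid RootedGraph where
  r R R' := ∃ φ : R.G ≃g R'.G, φ R.o = R'.o
  iseqv :=
    { refl := fun R => ⟨SimpleGraph.Iso.refl, rfl⟩
      symm := by
        rintro R R' ⟨φ, h⟩
        exact ⟨φ.symm, by rw [← h]; exact φ.symm_apply_apply _⟩
      trans := by
        rintro R R' R'' ⟨φ, h⟩ ⟨ψ, k⟩
        exact ⟨φ.trans ψ, by rw [← k, ← h]; rfl⟩ }

/-- Isomorphism of doubly rooted graphs. -/
instance BirootedGraph.setoid : Setoid BirootedGraph where
  r R R' := ∃ φ : R.G ≃g R'.G, φ R.o = R'.o ∧ φ R.ρ = R'.ρ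
  iseqv :=
    { refl := fun R => ⟨SimpleGraph.Iso.refl, rfl, rfl⟩
      symm := by
        rintro R R' ⟨φ, h, h'⟩
        exact ⟨φ.symm, by rw [← h]; exact φ.symm_apply_apply _,
          by rw [← h']; exact φ.symm_apply_apply _⟩
      trans := by
        rintro R R' R'' ⟨φ, h, h'⟩ ⟨ψ, k, k'⟩
        exact ⟨φ.trans ψ, by rw [← k, ← h]; rfl, by rw [← k', ← h']; rfl⟩ }

/-- The space of isomorphism classes of rooted graphs. -/
abbrev RootedClass := Quotient RootedGraph.setoid

/-- The space of isomorphism classes of doubly rooted graphs. -/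
abbrev BirootedClass := Quotient BirootedGraph.setoid

/-- The balls of radius `r` around the roots (with the induced graph structure) are isomorphic as
rooted graphs. -/
def RootedGraph.BallIso (r : ℕ) (R R' : RootedGraph) : Prop :=
  ∃ φ : R.G.induce (R.ball r) ≃g R'.G.induce (R'.ball r),
    ∀ v : R.ball r, (v : R.V) = R.o ↔ (φ v : R'.V) = R'.o

/-- The balls of radius `r` around the first roots are isomorphic through a map that matches the
first roots, and also the second roots as far as they lie in these balls. -/
def BirootedGraph.BallIso (r : ℕ) (R R' : BirootedGraph) : Prop :=
  ∃ φ : R.G.induce (R.toRootedGraph.ball r) ≃g R'.G.induce (R'.toRootedGraph.ball r),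
    (∀ v : R.toRootedGraph.ball r, (v : R.V) = R.o ↔ (φ v : R'.V) = R'.o) ∧
    (∀ v : R.toRootedGraph.ball r, (v : R.V) = R.ρ ↔ (φ v : R'.V) = R'.ρ)

/-- The local topology: a base is given by the sets of all classes of rooted graphs whose ball of
radius `r` around the root agrees with that of a given rooted graph. These sets are the balls of
the local metric `1 / (1 + r)`, `r` the largest radius up to which the balls are isomorphic. -/
instance : TopologicalSpace RootedClass :=
  TopologicalSpace.generateFrom
    {U | ∃ (r : ℕ) (R : RootedGraph), U = {g | ∃ R', ⟦R'⟧ = g ∧ R.BallIso r R'}}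

/-- The local topology on classes of doubly rooted graphs. -/
instance : TopologicalSpace BirootedClass :=
  TopologicalSpace.generateFrom
    {U | ∃ (r : ℕ) (R : BirootedGraph), U = {g | ∃ R', ⟦R'⟧ = g ∧ R.BallIso r R'}}

instance : MeasurableSpace RootedClass := borel _

instance : MeasurableSpace BirootedClass := borel _

/-! ### Markov chains on a countable set and simple random walk -/

section Chains

variable {V : Type} [Countable V] [MeasurableSpace V] [DiscreteMeasurableSpace V]

open Classical in
/-- The one-step distribution from `x` of the chain with transition probabilities `p`. At states
`x` where `p x` is not a probability vector the chain is put to rest. -/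
def stepMeasure (p : V → V → ℝ≥0∞) (x : V) : Measure V :=
  if ∑' y, p x y = 1 then Measure.sum (fun y => p x y • Measure.dirac y) else Measure.dirac x

/-- The transition kernel of the chain with transition probabilities `p`. -/
def stepKernel (p : V → V → ℝ≥0∞) : Kernel V V where
  toFun := stepMeasure p
  measurable' := measurable_of_countable _

instance (p : V → V → ℝ≥0∞) : IsMarkovKernel (stepKernel p) where
  isProbabilityMeasure x := by
    constructor
    change stepMeasure p x Set.univ = 1
    unfold stepMeasure
    split_ifs with h
    · simpa using h
    · simp

/-- The law on trajectories `ℕ → V` of the Markov chain with transition probabilities `p`, started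
from `x`. -/
def chainLaw (p : V → V → ℝ≥0∞) (x : V) : Measure (ℕ → V) :=
  Kernel.traj (X := fun _ => V)
    (fun n => (stepKernel p).comap (fun h => h ⟨n, Finset.mem_Iic.2 le_rfl⟩)
      (measurable_pi_apply _)) 0 (fun _ => x)

instance (p : V → V → ℝ≥0∞) (x : V) : IsProbabilityMeasure (chainLaw p x) := by
  unfold chainLaw; infer_instance

/-- The degree of a vertex. -/
def deg (G : SimpleGraph V) (x : V) : ℕ := (G.neighborSet x).ncard

open Classical in
/-- The transition probabilities of simple random walk. -/
def srwStep (G : SimpleGraph V) (x y : V) : ℝ≥0∞ :=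
  if G.Adj x y then ((deg G x : ℝ≥0∞))⁻¹ else 0

/-- Recurrence: simple random walk returns almost surely to its starting point. -/
def Recurrent (G : SimpleGraph V) : Prop :=
  ∀ x, ∀ᵐ ξ ∂(chainLaw (srwStep G) x), ∃ n, 1 ≤ n ∧ ξ n = x

/-- The hitting time `T_A = inf {n ≥ 0 : ξ n ∈ A}` of a trajectory. -/
def hitTime (A : Finset V) (ξ : ℕ → V) : ℕ∞ := ⨅ (n : ℕ) (_ : ξ n ∈ A), (n : ℕ∞)

open Classical in
/-- The Green function `Gr_A(x, y)`: the expected number of visits to `y` strictly before `T_A`, for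
simple random walk from `x`. -/
def green (G : SimpleGraph V) (A : Finset V) (x y : V) : ℝ≥0∞ :=
  ∫⁻ ξ, ∑' n : ℕ, (if (n : ℕ∞) < hitTime A ξ ∧ ξ n = y then 1 else 0) ∂(chainLaw (srwStep G) x)

/-- The normalised Green function `g_A(x, y) = Gr_A(x, y) / deg y`. It is finite for connected locally
finite graphs and nonempty `A`, the only case in which it is used. -/
def greenNorm (G : SimpleGraph V) (A : Finset V) (x y : V) : ℝ :=
  (green G A x y).toReal / deg G y

/-- The truncated potential kernel `a_A(x, y) = g_A(y, y) - g_A(x, y)`. -/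
def truncatedKernel (G : SimpleGraph V) (A : Finset V) (x y : V) : ℝ :=
  greenNorm G A y y - greenNorm G A x y

/-- The sets `A n` go to infinity: their graph distance from `o` tends to infinity. -/
def GoesToInfinity (G : SimpleGraph V) (o : V) (A : ℕ → Finset V) : Prop :=
  ∀ r : ℕ, ∀ᶠ n in atTop, ∀ v ∈ A n, r ≤ G.dist o v

/-- `a` is the potential kernel of `G`: for every sequence of finite nonempty sets going to infinity,
the truncated potential kernels converge pointwise to `a`. -/
def IsPotentialKernel (G : SimpleGraph V) (o : V) (a : V → V → ℝ) : Prop :=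
  ∀ A : ℕ → Finset V, (∀ n, (A n).Nonempty) → GoesToInfinity G o A →
    ∀ x y, Tendsto (fun n => truncatedKernel G (A n) x y) atTop (𝓝 (a x y))

open Classical in
/-- The transition probabilities of the random walk conditioned never to hit `o`: away from `o`, the
Doob transform of simple random walk by `a(·, o)`. The step out of `o`, which can only be the first
one, goes to the neighbour `y` of `o` with probability `a(y, o)`. -/
def crwStep (G : SimpleGraph V) (o : V) (a : V → V → ℝ) (x y : V) : ℝ≥0∞ :=
  if x = o then (if G.Adj o y then ENNReal.ofReal (a y o) else 0)
  else ENNReal.ofReal (a y o / a x o) * srwStep G x y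

/-- The law on trajectories of the random walk started from `x`, conditioned never to hit `o`. -/
def crwLaw (G : SimpleGraph V) (o : V) (a : V → V → ℝ) (x : V) : Measure (ℕ → V) :=
  chainLaw (crwStep G o a) x

instance (G : SimpleGraph V) (o : V) (a : V → V → ℝ) (x : V) :
    IsProbabilityMeasure (crwLaw G o a x) := by
  unfold crwLaw; infer_instance

end Chains

/-! ### Reversible random graphs -/

open Classical in
/-- The random rooted graph `R = (G, o)`, defined on a probability space `(Ω, P)`, is a random variable
in the space of rooted graphs and is reversible: `(G, o, X₁)` and `(G, X₁, o)` have the same law on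
the space of doubly rooted graphs, where, given `(G, o)`, the vertex `X₁` is the first step of simple
random walk from `o`. The sums over `x` are the conditional probabilities given `(G, o)`. -/
def IsReversible {Ω : Type*} [MeasurableSpace Ω] (P : Measure Ω) (R : Ω → RootedGraph) : Prop :=
  Measurable (fun ω => (⟦R ω⟧ : RootedClass)) ∧
  ∀ S : Set BirootedClass, MeasurableSet S →
    ∫⁻ ω, ∑' x, (if ⟦(R ω).withSecond x⟧ ∈ S then srwStep (R ω).G (R ω).o x else 0) ∂P =
    ∫⁻ ω, ∑' x, (if ⟦(R ω).withFirst x⟧ ∈ S then srwStep (R ω).G (R ω).o x else 0) ∂P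

end ReversibleGraph

end

open ReversibleGraph

/-! Write `g_o` for the degree-normalised Green function of simple random walk killed at `o`. On a
recurrent graph, bounded functions that are harmonic off a vertex are constant, and this gives
`g_b(o,o) - g_b(y,o) = g_o(y,b)` (`greenFn_sub_eq`). Hence `a(y,o)` is the limit of `g_o(y,b)` as
`b` leaves finite sets. In the same way `g_o(b,b) = a(b,o) + a(o,b)` (`IsPotentialKernel.add_swap`).

The conditioned walk is the Doob transform by `a(·,o)`, so its expected number of visits from `y` to
`b` is `a(b,o) deg(b) g_o(y,b) / a(y,o)` (`visits_crwStep`). The last quotient tends to 1, so the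
Martin kernel at infinity is trivial. By last exit decomposition, the probability of meeting a set
`A` in infinitely many points is then a constant `c` independent of the starting point. This event
is shift invariant, so it is independent of having hit `A` far away. Thus `c = c * c`.

The probability of hitting a far vertex `b` is asymptotically `a(b,o) / g_o(b,b)`, which is at least
1/2 if `a(o,b) ≤ a(b,o)`. Let `S` be the set of such vertices other than `o`. Every infinite subset
of `S` therefore has `c = 1` (`chainLaw_hitsInf_eq_one`). If `S` is infinite, the first walk meets
it infinitely often, and the second walk meets the infinite set of points of `S` visited by the
first.

It remains to see that `S` is almost surely infinite. The antisymmetric part of `a` is a gradient,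
`a(x,y) - a(y,x) = β(y) - β(x)`. So `a(x,y) ≤ a(y,x)` means `β(y) ≤ β(x)`. Among `k + 1` vertices,
one with maximal `β` dominates all of them, so at most `k` vertices dominate at most `k` vertices
(`finite_dominatedCount_le`). A property that holds at only finitely many vertices almost surely
fails at the root (`IsReversible.ae_notMem_of_finite`). Indeed, the environment seen from the walk
is stationary, while on an infinite recurrent graph the fraction of time spent in a finite set tends
to 0. Measurability of the count comes from Green functions killed on spheres, which depend on
finite balls only. -/

noncomputable section

namespace ReversibleGraph

/-! ### Markov chains on countable sets: first step analysis -/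

section Chain

variable {V : Type} [Countable V] [MeasurableSpace V] [DiscreteMeasurableSpace V]

/-- Prepend a point to a trajectory. -/
def consPath (x : V) (ξ : ℕ → V) : ℕ → V
  | 0 => x
  | n + 1 => ξ n

set_option linter.unusedSectionVars false in
lemma measurable_consPath (x : V) : Measurable (consPath x) := by
  refine measurable_pi_lambda _ fun n => ?_
  cases n with
  | zero => exact measurable_const
  | succ n => exact measurable_pi_apply n

/-- On a countable state space an initial segment has countably many values, so cylinders over
points determine the finite-dimensional laws. Projective limits are unique. -/
lemma ext_of_cylinder {μ ν : Measure (ℕ → V)} [IsProbabilityMeasure μ] [IsProbabilityMeasure ν]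
    (h : ∀ (n : ℕ) (a : ℕ → V), μ {ξ | ∀ i ≤ n, ξ i = a i} = ν {ξ | ∀ i ≤ n, ξ i = a i}) :
    μ = ν := by
  have hproj : ∀ (ρ : Measure (ℕ → V)) [IsProbabilityMeasure ρ],
      IsProjectiveMeasureFamily (α := fun _ : ℕ => V) (fun I => ρ.map I.restrict) := by
    intro ρ _ I J hJ
    rw [Measure.map_map (by fun_prop) (by fun_prop)]
    rfl
  have h2 : IsProjectiveLimit μ (fun I : Finset ℕ => ν.map I.restrict) := by
    rw [isProjectiveLimit_nat_iff (hproj ν)]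
    intro n
    refine Measure.ext_of_singleton fun a => ?_
    rw [Measure.map_apply (by fun_prop) (measurableSet_singleton a),
      Measure.map_apply (by fun_prop) (measurableSet_singleton a)]
    classical
    have := h n (fun i => if hi : i ≤ n then a ⟨i, Finset.mem_Iic.2 hi⟩ else
      a ⟨n, Finset.mem_Iic.2 le_rfl⟩)
    convert! this using 2 <;>
    · ext ξ
      simp only [Set.mem_preimage, Set.mem_singleton_iff, Set.mem_ofPred_eq, funext_iff]
      constructor
      · intro H i hi
        simpa [hi] using H ⟨i, Finset.mem_Iic.2 hi⟩
      · rintro H ⟨i, hi⟩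
        simpa [Finset.mem_Iic.1 hi] using H i (Finset.mem_Iic.1 hi)
  exact h2.unique (fun I => rfl)

lemma chainLaw_cylinder_zero (p : V → V → ℝ≥0∞) (x : V) (a : ℕ → V) :
    chainLaw p x {ξ | ∀ i ≤ 0, ξ i = a i} = Set.indicator {a 0} 1 x := by
  have h := Kernel.traj_map_frestrictLe_apply (X := fun _ => V)
    (κ := fun n => (stepKernel p).comap (fun h => h ⟨n, Finset.mem_Iic.2 le_rfl⟩)
      (measurable_pi_apply _)) 0 0 (fun _ => x)
  have h2 := congrArg (fun m => m {g | g ⟨0, Finset.mem_Iic.2 le_rfl⟩ = a 0}) h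
  have hm : MeasurableSet {g : (i : Finset.Iic 0) → V | g ⟨0, Finset.mem_Iic.2 le_rfl⟩ = a 0} :=
    measurableSet_eq_fun (measurable_pi_apply _) measurable_const
  beta_reduce at h2
  rw [Measure.map_apply (by fun_prop) hm, Kernel.partialTraj_self, Kernel.id_apply,
    Measure.dirac_apply' _ hm] at h2
  rw [chainLaw]
  convert! h2 using 2
  · ext ξ; simp [Preorder.frestrictLe]

lemma chainLaw_cylinder_succ (p : V → V → ℝ≥0∞) (x : V) (a : ℕ → V) (n : ℕ) :
    chainLaw p x {ξ | ∀ i ≤ n + 1, ξ i = a i} =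
      chainLaw p x {ξ | ∀ i ≤ n, ξ i = a i} * stepMeasure p (a n) {a (n + 1)} := by
  set κ : (n : ℕ) → Kernel ((i : Finset.Iic n) → V) V :=
    fun n => (stepKernel p).comap (fun h => h ⟨n, Finset.mem_Iic.2 le_rfl⟩)
      (measurable_pi_apply _) with hκ
  have h := Kernel.partialTraj_compProd_eq_map_traj (X := fun _ => V) (κ := κ) (a := 0) (b := n)
    (Nat.zero_le n) (x₀ := fun _ => x)
  rw [← Kernel.traj_map_frestrictLe_apply] at h
  set C : Set ((i : Finset.Iic n) → V) := {g | ∀ i, g i = a i} with hC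
  have hCm : MeasurableSet C := by
    rw [hC, Set.ofPred_forall]
    exact MeasurableSet.iInter fun i => measurableSet_eq_fun (measurable_pi_apply i) measurable_const
  have h2 := congrArg (fun m => m (C ×ˢ {a (n + 1)})) h
  beta_reduce at h2
  rw [Measure.compProd_apply_prod hCm (measurableSet_singleton _),
    Measure.map_apply (by fun_prop) (hCm.prod (measurableSet_singleton _))] at h2
  have e1 : ∀ m : Measure ((i : Finset.Iic n) → V), ∫⁻ g in C, (κ n g) {a (n + 1)} ∂m =
      ∫⁻ g in C, stepMeasure p (a n) {a (n + 1)} ∂m := by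
    intro m
    refine setLIntegral_congr_fun hCm fun g hg => ?_
    simp only [hκ, Kernel.comap_apply]
    rw [hg]; rfl
  rw [e1, setLIntegral_const, Measure.map_apply (by fun_prop) hCm] at h2
  have e2 : chainLaw p x = (Kernel.traj κ 0) fun _ => x := rfl
  rw [e2, mul_comm]
  convert! h2.symm using 2
  · ext ξ
    simp only [Set.mem_ofPred_eq, Set.mem_preimage, Set.mem_prod, Set.mem_singleton_iff, hC,
      Subtype.forall, Finset.mem_Iic, Preorder.frestrictLe_apply]
    constructor
    · exact fun H => ⟨fun i hi => H i (by omega), H _ le_rfl⟩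
    · rintro ⟨H1, H2⟩ i hi
      rcases Nat.lt_or_ge n i with h' | h'
      · obtain rfl : i = n + 1 := by omega
        exact H2
      · exact H1 i h'
  · congr 1
    ext ξ
    simp [hC]

lemma stepMeasure_isProbabilityMeasure (p : V → V → ℝ≥0∞) (x : V) :
    IsProbabilityMeasure (stepMeasure p x) :=
  inferInstanceAs (IsProbabilityMeasure (stepKernel p x))

/-- First step decomposition of the law of a Markov chain. -/
lemma chainLaw_eq_bind (p : V → V → ℝ≥0∞) (x : V) :
    chainLaw p x = (stepMeasure p x).bind (fun y => (chainLaw p y).map (consPath x)) := by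
  have hP := stepMeasure_isProbabilityMeasure p x
  have hm : AEMeasurable (fun y => (chainLaw p y).map (consPath x)) (stepMeasure p x) :=
    (measurable_of_countable _).aemeasurable
  have : IsProbabilityMeasure
      ((stepMeasure p x).bind (fun y => (chainLaw p y).map (consPath x))) := by
    constructor
    rw [Measure.bind_apply MeasurableSet.univ hm]
    simp [Measure.map_apply (measurable_consPath x)]
  refine ext_of_cylinder fun n => ?_
  have hcyl : ∀ (n : ℕ) (a : ℕ → V), MeasurableSet {ξ : ℕ → V | ∀ i ≤ n, ξ i = a i} := by
    intro n a
    simp only [Set.ofPred_forall]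
    exact MeasurableSet.iInter fun i => MeasurableSet.iInter fun _ =>
      measurableSet_eq_fun (measurable_pi_apply i) measurable_const
  intro a
  rw [Measure.bind_apply (hcyl n a) hm]
  simp only [Measure.map_apply (measurable_consPath x) (hcyl _ _)]
  by_cases hx : x = a 0
  swap
  · have e1 : ∀ y, chainLaw p y (consPath x ⁻¹' {ξ | ∀ i ≤ n, ξ i = a i}) = 0 := by
      intro y
      convert! measure_empty (μ := chainLaw p y)
      ext ξ
      simp only [Set.mem_preimage, Set.mem_ofPred_eq, Set.mem_empty_iff_false, iff_false]
      exact fun H => hx (H 0 (Nat.zero_le n))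
    simp only [e1, lintegral_zero]
    refine measure_mono_null (t := {ξ | ∀ i ≤ 0, ξ i = a i})
      (fun ξ (H : ∀ i ≤ n, ξ i = a i) i hi => H i (by omega)) ?_
    rw [chainLaw_cylinder_zero]
    simp [hx]
  have e2 : ∀ (m : ℕ) (y : V), chainLaw p y (consPath x ⁻¹' {ξ | ∀ i ≤ m + 1, ξ i = a i}) =
      chainLaw p y {ξ | ∀ i ≤ m, ξ i = a (i + 1)} := by
    intro m y
    congr 1
    ext ξ
    simp only [Set.mem_preimage, Set.mem_ofPred_eq]
    constructor
    · exact fun H i hi => H (i + 1) (by omega)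
    · intro H i hi
      cases i with
      | zero => exact hx
      | succ i => exact H i (by omega)
  cases n with
  | zero =>
    have e1 : ∀ y, chainLaw p y (consPath x ⁻¹' {ξ | ∀ i ≤ 0, ξ i = a i}) = 1 := by
      intro y
      convert! measure_univ (μ := chainLaw p y)
      ext ξ
      simp only [Set.mem_preimage, Set.mem_ofPred_eq, Set.mem_univ, iff_true]
      intro i hi
      obtain rfl : i = 0 := by omega
      exact hx
    simp only [e1, lintegral_one, measure_univ]
    rw [chainLaw_cylinder_zero]
    simp [hx]
  | succ n =>
    -- Lengthening the cylinder multiplies both sides by the same last transition probability.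
    simp only [e2]
    induction n with
    | zero =>
      rw [chainLaw_cylinder_succ, chainLaw_cylinder_zero]
      have : ∀ y, chainLaw p y {ξ | ∀ i ≤ 0, ξ i = a (i + 1)} = Set.indicator {a 1} 1 y :=
        fun y => chainLaw_cylinder_zero p y (fun i => a (i + 1))
      simp only [this]
      rw [lintegral_indicator_one (measurableSet_singleton _)]
      simp [hx]
    | succ n ih =>
      rw [chainLaw_cylinder_succ, ih]
      have : ∀ y, chainLaw p y {ξ | ∀ i ≤ n + 1, ξ i = a (i + 1)} = _ :=
        fun y => chainLaw_cylinder_succ p y (fun i => a (i + 1)) n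
      simp only [this]
      rw [lintegral_mul_const _ (measurable_of_countable _)]

lemma chainLaw_apply (p : V → V → ℝ≥0∞) (x : V) (hp : ∑' y, p x y = 1) {E : Set (ℕ → V)}
    (hE : MeasurableSet E) :
    chainLaw p x E = ∑' y, p x y * chainLaw p y (consPath x ⁻¹' E) := by
  have hm : AEMeasurable (fun y => (chainLaw p y).map (consPath x)) (stepMeasure p x) :=
    (measurable_of_countable _).aemeasurable
  rw [chainLaw_eq_bind, Measure.bind_apply hE hm]
  simp only [Measure.map_apply (measurable_consPath x) hE]
  rw [stepMeasure, if_pos hp, lintegral_sum_measure]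
  simp

lemma chainLaw_start (p : V → V → ℝ≥0∞) (x : V) : ∀ᵐ ξ ∂(chainLaw p x), ξ 0 = x := by
  have h := chainLaw_cylinder_zero p x (fun _ => x)
  simp only [Set.mem_singleton_iff, Set.indicator_of_mem, Pi.one_apply] at h
  have h2 : {ξ : ℕ → V | ∀ i ≤ 0, ξ i = x} = {ξ | ξ 0 = x} := by ext ξ; simp
  rw [h2] at h
  exact (prob_compl_eq_zero_iff (measurableSet_eq_fun (measurable_pi_apply 0) measurable_const)).2 h

end Chain

/-! ### Zero-one law for transient chains with trivial Martin kernel -/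

section ChainLiouville

set_option linter.unusedSectionVars false

variable {V : Type} [Countable V] [MeasurableSpace V] [DiscreteMeasurableSpace V]

lemma chainLaw_apply_lintegral (p : V → V → ℝ≥0∞) (x : V) {E : Set (ℕ → V)}
    (hE : MeasurableSet E) :
    chainLaw p x E = ∫⁻ y, chainLaw p y (consPath x ⁻¹' E) ∂(stepMeasure p x) := by
  have hm : AEMeasurable (fun y => (chainLaw p y).map (consPath x)) (stepMeasure p x) :=
    (measurable_of_countable _).aemeasurable
  conv_lhs => rw [chainLaw_eq_bind, Measure.bind_apply hE hm]
  simp only [Measure.map_apply (measurable_consPath x) hE]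

lemma measurableSet_path_mem (n : ℕ) (B : Set V) : MeasurableSet {ξ : ℕ → V | ξ n ∈ B} :=
  (measurable_pi_apply n) (MeasurableSet.of_discrete (s := B))

/-- Shift a trajectory by `n` steps. -/
def shiftPath (n : ℕ) (ξ : ℕ → V) : ℕ → V := fun k => ξ (n + k)

lemma measurable_shiftPath (n : ℕ) : Measurable (shiftPath (V := V) n) :=
  measurable_pi_lambda _ fun _ => measurable_pi_apply _

/-- The Markov property at a fixed time. -/
lemma chainLaw_markov (p : V → V → ℝ≥0∞) (n : ℕ) (x b : V) {E : Set (ℕ → V)}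
    (hE : MeasurableSet E) :
    chainLaw p x ({ξ | ξ n = b} ∩ shiftPath n ⁻¹' E) =
      chainLaw p x {ξ | ξ n = b} * chainLaw p b E := by
  have hs : ∀ n, MeasurableSet {ξ : ℕ → V | ξ n = b} := fun n => measurableSet_path_mem n {b}
  have hE' : ∀ n, MeasurableSet (shiftPath n ⁻¹' E) := fun n => measurable_shiftPath n hE
  induction n generalizing x with
  | zero =>
    have hE0 : (shiftPath 0 ⁻¹' E : Set (ℕ → V)) = E := by
      ext ξ
      have : shiftPath 0 ξ = ξ := by funext k; simp [shiftPath]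
      simp [this]
    rw [hE0]
    by_cases hx : x = b
    · subst hx
      have h1 : chainLaw p x {ξ | ξ 0 = x} = 1 := (mem_ae_iff_prob_eq_one (hs 0)).1
        (chainLaw_start p x)
      rw [h1, one_mul]
      refine measure_congr ?_
      filter_upwards [chainLaw_start p x] with ξ hξ
      change (ξ 0 = x ∧ ξ ∈ E) = (ξ ∈ E)
      simp [hξ]
    · have h1 : chainLaw p x {ξ | ξ 0 = b} = 0 := by
        refine measure_mono_null (t := {ξ | ¬ ξ 0 = x}) ?_ (chainLaw_start p x)
        intro ξ hξ h
        exact hx (h.symm.trans hξ)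
      rw [h1, zero_mul]
      exact measure_mono_null Set.inter_subset_left h1
  | succ n ih =>
    rw [chainLaw_apply_lintegral p x ((hs _).inter (hE' _)), chainLaw_apply_lintegral p x (hs _),
      ← lintegral_mul_const _ (measurable_of_countable _)]
    refine lintegral_congr fun y => ?_
    have e1 : consPath x ⁻¹' {ξ | ξ (n + 1) = b} = {ξ | ξ n = b} := rfl
    have e2 : consPath x ⁻¹' (shiftPath (n + 1) ⁻¹' E) = shiftPath n ⁻¹' E := by
      ext ξ
      have : shiftPath (n + 1) (consPath x ξ) = shiftPath n ξ := by
        funext k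
        simp only [shiftPath, show n + 1 + k = (n + k) + 1 by omega, consPath]
      simp only [Set.mem_preimage, this]
    rw [Set.preimage_inter, e1, e2, ih]

/-- The expected number of visits to `b` of the chain from `y`. -/
def visits (p : V → V → ℝ≥0∞) (y b : V) : ℝ≥0∞ := ∑' n, chainLaw p y {ξ | ξ n = b}

/-- The set of trajectories that hit `B`. -/
def hits (B : Set V) : Set (ℕ → V) := {ξ | ∃ n, ξ n ∈ B}

lemma measurableSet_hits (B : Set V) : MeasurableSet (hits B) := by
  have : hits B = ⋃ n, {ξ : ℕ → V | ξ n ∈ B} := by ext; simp [hits]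
  rw [this]
  exact MeasurableSet.iUnion fun n => measurableSet_path_mem n B

/-- The probability to escape from `B`, starting at `b`. -/
def escape (p : V → V → ℝ≥0∞) (B : Set V) (b : V) : ℝ≥0∞ :=
  chainLaw p b {ξ | ∀ m, ξ (m + 1) ∉ B}

lemma measurableSet_escape (B : Set V) : MeasurableSet {ξ : ℕ → V | ∀ m, ξ (m + 1) ∉ B} := by
  have : {ξ : ℕ → V | ∀ m, ξ (m + 1) ∉ B} = ⋂ m, {ξ : ℕ → V | ξ (m + 1) ∈ Bᶜ} := by ext; simp
  rw [this]
  exact MeasurableSet.iInter fun n => measurableSet_path_mem _ _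

/-- Last exit decomposition of the probability to hit a finite set. -/
lemma chainLaw_hits_finset (p : V → V → ℝ≥0∞) (y : V) (B : Finset V)
    (hB : ∀ b ∈ B, visits p y b ≠ ∞) :
    chainLaw p y (hits B) = ∑ b ∈ B, visits p y b * escape p B b := by
  -- By Borel–Cantelli, finite expectations leave finitely many visits, so a path that hits `B` has
  -- a last visit.
  have hfin : ∀ᵐ ξ ∂(chainLaw p y), ∀ b ∈ B, {n | ξ n = b}.Finite := by
    refine (ae_ball_iff B.countable_toSet).2 fun b hb => ?_
    exact ae_finite_setOfPred_mem (hB b hb)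
  -- `T n b` says that the last visit to `B` happens at time `n` and at the point `b`. These events
  -- are disjoint.
  set T : ℕ → V → Set (ℕ → V) := fun n b => {ξ | ξ n = b} ∩
    shiftPath n ⁻¹' {ξ | ∀ m, ξ (m + 1) ∉ (B : Set V)} with hT
  have hTm : ∀ n b, MeasurableSet (T n b) := fun n b =>
    (measurableSet_path_mem n {b}).inter (measurable_shiftPath n (measurableSet_escape _))
  have hTp : ∀ n b, chainLaw p y (T n b) = chainLaw p y {ξ | ξ n = b} * escape p B b :=
    fun n b => chainLaw_markov p n y b (measurableSet_escape _)
  have hae : (hits B : Set (ℕ → V)) =ᵐ[chainLaw p y] ⋃ n, ⋃ b ∈ B, T n b := by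
    filter_upwards [hfin] with ξ hξ
    have : {n | ξ n ∈ B}.Finite := by
      have e : {n | ξ n ∈ B} = ⋃ b ∈ B, {n | ξ n = b} := by ext; simp
      rw [e]
      exact B.finite_toSet.biUnion hξ
    refine propext ⟨?_, ?_⟩
    · rintro ⟨n, hn⟩
      obtain ⟨N, hN1, hN2⟩ := this.exists_maximal ⟨n, hn⟩
      refine Set.mem_iUnion.2 ⟨N, Set.mem_iUnion₂.2 ⟨ξ N, hN1, rfl, ?_⟩⟩
      intro m hm
      have := hN2 (y := N + (m + 1)) hm (by omega)
      omega
    · intro h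
      obtain ⟨n, h⟩ := Set.mem_iUnion.1 h
      obtain ⟨b, hb, h1, h2⟩ := Set.mem_iUnion₂.1 h
      exact ⟨n, by rw [show ξ n = b from h1]; exact hb⟩
  rw [measure_congr hae, measure_iUnion]
  · have : ∀ n, chainLaw p y (⋃ b ∈ B, T n b) = ∑ b ∈ B, chainLaw p y (T n b) := by
      intro n
      refine measure_biUnion_finset ?_ fun b _ => hTm n b
      intro b _ b' _ hbb
      exact Set.disjoint_left.2 fun ξ h1 h2 => hbb (h1.1.symm.trans h2.1)
    simp only [this, hTp]
    rw [Summable.tsum_finsetSum fun _ _ => ENNReal.summable]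
    simp only [ENNReal.tsum_mul_right, visits]
  · have key : ∀ n n' : ℕ, n < n' → Disjoint (⋃ b ∈ B, T n b) (⋃ b ∈ B, T n' b) := by
      intro n n' hnn
      refine Set.disjoint_left.2 fun ξ h1 h2 => ?_
      obtain ⟨b, hb, h1, h1'⟩ := Set.mem_iUnion₂.1 h1
      obtain ⟨b', hb', h2, h2'⟩ := Set.mem_iUnion₂.1 h2
      refine h1' (n' - n - 1) ?_
      simp only [shiftPath]
      rw [show n + (n' - n - 1 + 1) = n' by omega, show ξ n' = b' from h2]
      exact hb'
    intro n n' hnn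
    rcases lt_or_gt_of_ne hnn with h | h
    · exact key n n' h
    · exact (key n' n h).symm
  · exact fun n => Finset.measurableSet_biUnion _ fun b _ => hTm n b

lemma chainLaw_hits_eq_iSup (p : V → V → ℝ≥0∞) (y : V) (B : Set V) :
    chainLaw p y (hits B) = ⨆ s : {s : Finset V // (s : Set V) ⊆ B}, chainLaw p y (hits s.1) := by
  classical
  have e : hits B = ⋃ s : {s : Finset V // (s : Set V) ⊆ B}, hits (s.1 : Set V) := by
    ext ξ
    simp only [hits, Set.mem_iUnion]
    constructor
    · rintro ⟨n, hn⟩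
      exact ⟨⟨{ξ n}, by simpa using hn⟩, n, by simp⟩
    · rintro ⟨s, n, hn⟩
      exact ⟨n, s.2 hn⟩
  rw [e, Directed.measure_iUnion]
  intro s t
  refine ⟨⟨s.1 ∪ t.1, by simp [s.2, t.2]⟩, ?_, ?_⟩
  · rintro ξ ⟨n, hn⟩
    exact ⟨n, by simp_all⟩
  · rintro ξ ⟨n, hn⟩
    exact ⟨n, by simp_all⟩

/-- In the last exit decomposition the escape probabilities do not see the starting point, so a
comparison of visit counts passes to hitting probabilities. -/
lemma chainLaw_hits_le (p : V → V → ℝ≥0∞) {y y' : V} {B : Set V} {C : ℝ≥0∞}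
    (hy : ∀ b, visits p y b ≠ ∞) (hy' : ∀ b, visits p y' b ≠ ∞)
    (h : ∀ b ∈ B, visits p y b ≤ C * visits p y' b) :
    chainLaw p y (hits B) ≤ C * chainLaw p y' (hits B) := by
  rw [chainLaw_hits_eq_iSup p y]
  refine iSup_le fun s => ?_
  calc chainLaw p y (hits s.1) ≤ C * chainLaw p y' (hits s.1) := by
        rw [chainLaw_hits_finset p y s.1 fun b _ => hy b,
          chainLaw_hits_finset p y' s.1 fun b _ => hy' b, Finset.mul_sum]
        refine Finset.sum_le_sum fun b hb => ?_
        rw [← mul_assoc]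
        exact mul_le_mul_left (h b (s.2 hb)) _
    _ ≤ _ := mul_le_mul_right (measure_mono (by rintro ξ ⟨n, hn⟩; exact ⟨n, s.2 hn⟩)) _

/-- The set of trajectories whose trace meets `A` in infinitely many points. -/
def hitsInf (A : Set V) : Set (ℕ → V) := {ξ | (Set.range ξ ∩ A).Infinite}

lemma hitsInf_eq_iInter (A : Set V) :
    hitsInf A = ⋂ F : Finset V, hits (A \ F) := by
  ext ξ
  simp only [hitsInf, hits, Set.mem_iInter]
  constructor
  · intro h F
    obtain ⟨_, ⟨⟨n, rfl⟩, ha⟩, hF⟩ := h.exists_notMem_finset F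
    exact ⟨n, ha, hF⟩
  · intro h
    refine fun hfin => ?_
    obtain ⟨n, hn1, hn2⟩ := h hfin.toFinset
    exact hn2 (by simpa using hn1)

lemma measurableSet_hitsInf (A : Set V) : MeasurableSet (hitsInf A) := by
  rw [hitsInf_eq_iInter]
  exact MeasurableSet.iInter fun F => measurableSet_hits _

lemma chainLaw_hitsInf (p : V → V → ℝ≥0∞) (y : V) (A : Set V) :
    chainLaw p y (hitsInf A) = ⨅ F : Finset V, chainLaw p y (hits (A \ F)) := by
  classical
  rw [hitsInf_eq_iInter, Directed.measure_iInter]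
  · exact fun F => (measurableSet_hits _).nullMeasurableSet
  · intro s t
    refine ⟨s ∪ t, ?_, ?_⟩
    · rintro ξ ⟨n, hn⟩
      exact ⟨n, hn.1, fun h => hn.2 (by simp_all)⟩
    · rintro ξ ⟨n, hn⟩
      exact ⟨n, hn.1, fun h => hn.2 (by simp_all)⟩
  · exact ⟨∅, measure_ne_top _ _⟩

lemma le_of_forall_one_lt_le_mul {a b : ℝ≥0∞} (hb : b ≠ ∞)
    (h : ∀ C : ℝ≥0∞, 1 < C → C ≠ ∞ → a ≤ C * b) : a ≤ b := by
  have h1 : Tendsto (fun n : ℕ => (1 + ((n : ℝ≥0∞) + 1)⁻¹) * b) atTop (𝓝 ((1 + 0) * b)) := by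
    refine ENNReal.Tendsto.mul_const ?_ (Or.inr hb)
    refine tendsto_const_nhds.add ?_
    have := (tendsto_add_atTop_iff_nat 1).2 ENNReal.tendsto_inv_nat_nhds_zero
    simpa using this
  rw [add_zero, one_mul] at h1
  refine ge_of_tendsto' h1 fun n => h _ ?_ ?_
  · refine ENNReal.lt_add_right ENNReal.one_ne_top ?_
    simp
  · simp

/-- Meeting `A` infinitely often is unaffected by discarding a finite part of `A`. On the remaining
points the visit counts compare with a factor `C`, and `C` decreases to 1. -/
lemma chainLaw_hitsInf_le (p : V → V → ℝ≥0∞) {y y' : V} (A : Set V)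
    (hy : ∀ b, visits p y b ≠ ∞) (hy' : ∀ b, visits p y' b ≠ ∞)
    (h : ∀ C : ℝ≥0∞, 1 < C → C ≠ ∞ → ∀ᶠ b in cofinite, visits p y b ≤ C * visits p y' b) :
    chainLaw p y (hitsInf A) ≤ chainLaw p y' (hitsInf A) := by
  classical
  refine le_of_forall_one_lt_le_mul (measure_ne_top _ _) fun C hC hC' => ?_
  have hF := h C hC hC'
  rw [Filter.eventually_cofinite] at hF
  rw [chainLaw_hitsInf p y', ENNReal.mul_iInf_of_ne (by positivity) hC']
  refine le_iInf fun F => ?_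
  calc chainLaw p y (hitsInf A) ≤ chainLaw p y (hits (A \ ↑(F ∪ hF.toFinset))) := by
        rw [chainLaw_hitsInf]
        exact iInf_le _ _
    _ ≤ C * chainLaw p y' (hits (A \ ↑(F ∪ hF.toFinset))) := by
        refine chainLaw_hits_le p hy hy' fun b hb => ?_
        have := hb.2
        simp only [Finset.coe_union, Set.Finite.coe_toFinset, Set.mem_union, not_or] at this
        exact not_not.1 this.2
    _ ≤ _ := by
        refine mul_le_mul_right (measure_mono ?_) _
        rintro ξ ⟨n, hn⟩
        exact ⟨n, hn.1, fun h => hn.2 (by simp_all)⟩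

lemma consPath_preimage_hitsInf (x : V) (A : Set V) : consPath x ⁻¹' hitsInf A = hitsInf A := by
  ext ξ
  have h : Set.range (consPath x ξ) = insert x (Set.range ξ) := by
    ext v
    constructor
    · rintro ⟨n, rfl⟩
      cases n with
      | zero => exact Or.inl rfl
      | succ n => exact Or.inr ⟨n, rfl⟩
    · rintro (rfl | ⟨n, rfl⟩)
      · exact ⟨0, rfl⟩
      · exact ⟨n + 1, rfl⟩
  change (Set.range (consPath x ξ) ∩ A).Infinite ↔ (Set.range ξ ∩ A).Infinite
  rw [h]
  constructor
  · intro H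
    by_contra h2
    rw [Set.not_infinite] at h2
    refine H ((h2.insert x).subset ?_)
    rintro v ⟨rfl | hv, hA⟩
    · exact Or.inl rfl
    · exact Or.inr ⟨hv, hA⟩
  · exact fun H => H.mono (Set.inter_subset_inter_left _ (Set.subset_insert _ _))

/-- A shift invariant event whose probability does not depend on the starting point is independent
of hitting a set. -/
lemma chainLaw_hits_inter (p : V → V → ℝ≥0∞) {K : Set V} (hK : ∀ x ∈ K, stepMeasure p x Kᶜ = 0)
    {E : Set (ℕ → V)} (hE : MeasurableSet E) (hE' : ∀ x, consPath x ⁻¹' E = E) {c : ℝ≥0∞}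
    (hc : ∀ x ∈ K, chainLaw p x E = c) (B : Set V) {x : V} (hx : x ∈ K) :
    chainLaw p x (hits B ∩ E) = c * chainLaw p x (hits B) := by
  set H : ℕ → Set (ℕ → V) := fun n => {ξ | ∃ m ≤ n, ξ m ∈ B} with hH
  have hHm : ∀ n, MeasurableSet (H n) := by
    intro n
    have : H n = ⋃ m, ⋃ _ : m ≤ n, {ξ : ℕ → V | ξ m ∈ B} := by ext; simp [hH]
    rw [this]
    exact MeasurableSet.iUnion fun m => MeasurableSet.iUnion fun _ => measurableSet_path_mem m B
  have hmono : Monotone H := fun n m hnm ξ ⟨k, hk, h⟩ => ⟨k, hk.trans hnm, h⟩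
  have hU : hits B = ⋃ n, H n := by
    ext ξ
    simp only [hits, hH, Set.mem_iUnion]
    exact ⟨fun ⟨n, h⟩ => ⟨n, n, le_rfl, h⟩, fun ⟨n, m, _, h⟩ => ⟨m, h⟩⟩
  -- Induction on the time horizon replaces the strong Markov property at the first hitting time: a
  -- start in `B` has already hit, and any other start makes one step inside `K`.
  have key : ∀ n, ∀ x ∈ K, chainLaw p x (H n ∩ E) = c * chainLaw p x (H n) := by
    have hxB : ∀ n, ∀ x ∈ K, x ∈ B → chainLaw p x (H n ∩ E) = c * chainLaw p x (H n) := by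
      intro n x hxK hx
      have h1 : ∀ᵐ ξ ∂chainLaw p x, ξ ∈ H n := by
        filter_upwards [chainLaw_start p x] with ξ hξ
        exact ⟨0, Nat.zero_le n, by rw [hξ]; exact hx⟩
      have h2 : chainLaw p x (H n) = 1 := (mem_ae_iff_prob_eq_one (hHm n)).1 h1
      rw [h2, mul_one, ← hc x hxK]
      refine measure_congr ?_
      filter_upwards [h1] with ξ hξ
      change (ξ ∈ H n ∧ ξ ∈ E) = (ξ ∈ E)
      simp [hξ]
    intro n
    induction n with
    | zero =>
      intro x hxK
      by_cases hx : x ∈ B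
      · exact hxB 0 x hxK hx
      · have h2 : chainLaw p x (H 0) = 0 := by
          refine measure_mono_null (t := {ξ | ¬ ξ 0 = x}) ?_ (chainLaw_start p x)
          rintro ξ ⟨m, hm, hξ⟩ h
          obtain rfl : m = 0 := by omega
          rw [show ξ 0 = x from h] at hξ
          exact hx hξ
        rw [h2, mul_zero]
        exact measure_mono_null Set.inter_subset_left h2
    | succ n ih =>
      intro x hxK
      by_cases hx : x ∈ B
      · exact hxB _ x hxK hx
      · have e : consPath x ⁻¹' (H (n + 1)) = H n := by
          ext ξ
          constructor
          · rintro ⟨m, hm, hξ⟩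
            cases m with
            | zero => exact absurd hξ hx
            | succ m => exact ⟨m, by omega, hξ⟩
          · rintro ⟨m, hm, hξ⟩
            exact ⟨m + 1, by omega, hξ⟩
        rw [chainLaw_apply_lintegral p x ((hHm _).inter hE), chainLaw_apply_lintegral p x (hHm _),
          ← lintegral_const_mul _ (measurable_of_countable _)]
        refine lintegral_congr_ae ?_
        have : ∀ᵐ y ∂stepMeasure p x, y ∈ K := hK x hxK
        filter_upwards [this] with y hy
        rw [Set.preimage_inter, hE', e, ih y hy]
  rw [hU, Set.iUnion_inter, Monotone.measure_iUnion (fun n m hnm =>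
    Set.inter_subset_inter_left _ (hmono hnm)), hmono.measure_iUnion, ENNReal.mul_iSup]
  exact iSup_congr fun n => key n x hx

/-- A transient chain whose Martin kernel at infinity is trivial hits infinitely many points of any
infinite set of points that are hit with probability bounded from below. -/
lemma chainLaw_hitsInf_eq_one (p : V → V → ℝ≥0∞) {K : Set V}
    (hK : ∀ x ∈ K, stepMeasure p x Kᶜ = 0)
    (htrans : ∀ y ∈ K, ∀ b, visits p y b ≠ ∞)
    (hmartin : ∀ y ∈ K, ∀ y' ∈ K, ∀ C : ℝ≥0∞, 1 < C → C ≠ ∞ →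
      ∀ᶠ b in cofinite, visits p y b ≤ C * visits p y' b)
    {S : Set V} (hSK : S ⊆ K) {δ : ℝ≥0∞} (hδ : δ ≠ 0)
    (hS : ∀ y ∈ K, ∀ᶠ b in cofinite, b ∈ S → δ * visits p b b ≤ visits p y b)
    {A : Set V} (hA : A.Infinite) (hAS : A ⊆ S) {y : V} (hy : y ∈ K) :
    chainLaw p y (hitsInf A) = 1 := by
  classical
  set c := chainLaw p y (hitsInf A) with hc
  have hconst : ∀ x ∈ K, chainLaw p x (hitsInf A) = c := fun x hx =>
    le_antisymm (chainLaw_hitsInf_le p A (htrans x hx) (htrans y hy) (hmartin x hx y hy))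
      (chainLaw_hitsInf_le p A (htrans y hy) (htrans x hx) (hmartin y hy x hx))
  -- `hitsInf A` lies inside `hits (A \ F)`, so independence gives `c * P(hits (A \ F)) = c` for
  -- every finite `F`. The infimum over `F` turns the second factor into `c`.
  have hcc : c * c = c := by
    conv_lhs => enter [2]; rw [hc, chainLaw_hitsInf]
    rw [ENNReal.mul_iInf (fun h => absurd h (measure_ne_top _ _))]
    have : ∀ F : Finset V, c * chainLaw p y (hits (A \ F)) = c := by
      intro F
      rw [← chainLaw_hits_inter p hK (measurableSet_hitsInf A)
        (fun x => consPath_preimage_hitsInf x A) hconst _ hy, Set.inter_eq_right.2]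
      rw [hitsInf_eq_iInter]
      exact Set.iInter_subset _ F
    exact (iInf_congr this).trans ciInf_const
  -- Outside any finite `F` there is a far point `b` of `A`. Its hitting probability is the ratio of
  -- `visits p y b` to `visits p b b`, because the last exit decomposition started at `b` makes the
  -- escape probability the reciprocal of the latter.
  have hcpos : δ ≤ c := by
    rw [hc, chainLaw_hitsInf]
    refine le_iInf fun F => ?_
    have h1 := hS y hy
    rw [Filter.eventually_cofinite] at h1
    obtain ⟨b, hbA, hb⟩ := hA.exists_notMem_finset (F ∪ h1.toFinset : Finset V)
    simp only [Finset.mem_union, Set.Finite.mem_toFinset, not_or] at hb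
    have hb2 : δ * visits p b b ≤ visits p y b := by
      have := hb.2
      have h3 : ¬ ¬ (b ∈ S → δ * visits p b b ≤ visits p y b) := this
      exact not_not.1 h3 (hAS hbA)
    have h4 : chainLaw p b (hits {b}) = 1 := by
      refine (mem_ae_iff_prob_eq_one (measurableSet_hits _)).1 ?_
      filter_upwards [chainLaw_start p b] with ξ hξ
      exact ⟨0, hξ⟩
    have h5 := chainLaw_hits_finset p b {b} fun b' _ => htrans b (hSK (hAS hbA)) b'
    have h6 := chainLaw_hits_finset p y {b} fun b' _ => htrans y hy b'
    simp only [Finset.coe_singleton, Finset.sum_singleton] at h5 h6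
    rw [h4] at h5
    calc δ = δ * visits p b b * escape p {b} b := by rw [mul_assoc, ← h5, mul_one]
      _ ≤ visits p y b * escape p {b} b := mul_le_mul_left hb2 _
      _ = chainLaw p y (hits {b}) := h6.symm
      _ ≤ _ := by
        refine measure_mono ?_
        rintro ξ ⟨n, hn⟩
        refine ⟨n, ?_⟩
        rw [show ξ n = b from hn]
        exact ⟨hbA, hb.1⟩
  have hc0 : c ≠ 0 := fun h => hδ (le_zero_iff.1 (h ▸ hcpos))
  have hct : c ≠ ∞ := measure_ne_top _ _
  exact (ENNReal.mul_eq_left hc0 hct).1 hcc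

lemma measurableSet_infinite_inter_range :
    MeasurableSet {ξ : (ℕ → V) × (ℕ → V) | (Set.range ξ.1 ∩ Set.range ξ.2).Infinite} := by
  have : {ξ : (ℕ → V) × (ℕ → V) | (Set.range ξ.1 ∩ Set.range ξ.2).Infinite} =
      ⋂ F : Finset V, ⋃ v : V, ⋃ _ : v ∉ F, (Prod.fst ⁻¹' hits {v} ∩ Prod.snd ⁻¹' hits {v}) := by
    ext ξ
    simp only [Set.mem_iInter, Set.mem_iUnion]
    constructor
    · intro h F
      obtain ⟨v, ⟨⟨n, hn⟩, ⟨m, hm⟩⟩, hF⟩ := h.exists_notMem_finset F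
      exact ⟨v, hF, ⟨n, hn⟩, ⟨m, hm⟩⟩
    · intro h hfin
      obtain ⟨v, hv, ⟨n, hn⟩, ⟨m, hm⟩⟩ := h hfin.toFinset
      exact hv (by simpa using ⟨⟨n, hn⟩, ⟨m, hm⟩⟩)
  rw [this]
  exact MeasurableSet.iInter fun F => MeasurableSet.iUnion fun v => MeasurableSet.iUnion fun _ =>
    (measurable_fst (measurableSet_hits _)).inter (measurable_snd (measurableSet_hits _))

/-- Two independent copies of a chain as in `chainLaw_hitsInf_eq_one` have traces with infinite
intersection. -/
lemma ae_infinite_inter_range (p : V → V → ℝ≥0∞) {K : Set V}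
    (hK : ∀ x ∈ K, stepMeasure p x Kᶜ = 0)
    (htrans : ∀ y ∈ K, ∀ b, visits p y b ≠ ∞)
    (hmartin : ∀ y ∈ K, ∀ y' ∈ K, ∀ C : ℝ≥0∞, 1 < C → C ≠ ∞ →
      ∀ᶠ b in cofinite, visits p y b ≤ C * visits p y' b)
    {S : Set V} (hSK : S ⊆ K) (hSinf : S.Infinite) {δ : ℝ≥0∞} (hδ : δ ≠ 0)
    (hS : ∀ y ∈ K, ∀ᶠ b in cofinite, b ∈ S → δ * visits p b b ≤ visits p y b)
    {x y : V} (hx : stepMeasure p x Kᶜ = 0) (hy : stepMeasure p y Kᶜ = 0) :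
    ∀ᵐ ξ ∂((chainLaw p x).prod (chainLaw p y)), (Set.range ξ.1 ∩ Set.range ξ.2).Infinite := by
  -- The start itself may lie outside `K` as long as its first step enters `K`. This covers the
  -- conditioned walk started at its root.
  have key : ∀ A : Set V, A.Infinite → A ⊆ S → ∀ z, stepMeasure p z Kᶜ = 0 →
      ∀ᵐ ξ ∂(chainLaw p z), ξ ∈ hitsInf A := by
    intro A hA hAS z hz
    refine (mem_ae_iff_prob_eq_one (measurableSet_hitsInf A)).2 ?_
    have hP := stepMeasure_isProbabilityMeasure p z
    rw [chainLaw_apply_lintegral p z (measurableSet_hitsInf A), consPath_preimage_hitsInf]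
    have h1 : ∀ᵐ w ∂stepMeasure p z, chainLaw p w (hitsInf A) = 1 := by
      have : ∀ᵐ w ∂stepMeasure p z, w ∈ K := hz
      filter_upwards [this] with w hw
      exact chainLaw_hitsInf_eq_one p hK htrans hmartin hSK hδ hS hA hAS hw
    rw [lintegral_congr_ae h1, lintegral_one, measure_univ]
  refine (Measure.ae_prod_mem_iff_ae_ae_mem measurableSet_infinite_inter_range).2 ?_
  filter_upwards [key S hSinf subset_rfl x hx] with ξ hξ
  -- With the first path frozen, its trace on `S` is a deterministic infinite target for the second
  -- walk.
  filter_upwards [key (Set.range ξ ∩ S) hξ Set.inter_subset_right y hy] with η hη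
  refine Set.Infinite.mono ?_ hη
  rintro v ⟨h1, h2, -⟩
  exact ⟨h2, h1⟩

end ChainLiouville

/-! ### Averaging, killed walks and Green functions -/

section Green

variable {V : Type} (G : SimpleGraph V) [G.LocallyFinite]

/-- The average of `f` over the neighbours of `x`. -/
def avg (f : V → ℝ) (x : V) : ℝ := (∑ z ∈ G.neighborFinset x, f z) / G.degree x

variable {G}

lemma avg_add (f g : V → ℝ) (x : V) : avg G (fun z => f z + g z) x = avg G f x + avg G g x := by
  simp only [avg, Finset.sum_add_distrib, add_div]

lemma avg_sub (f g : V → ℝ) (x : V) : avg G (fun z => f z - g z) x = avg G f x - avg G g x := by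
  simp only [avg, Finset.sum_sub_distrib, sub_div]

lemma avg_mul_left (c : ℝ) (f : V → ℝ) (x : V) : avg G (fun z => c * f z) x = c * avg G f x := by
  simp only [avg, ← Finset.mul_sum, mul_div_assoc]

lemma avg_mono {f g : V → ℝ} {x : V} (h : ∀ z, G.Adj x z → f z ≤ g z) :
    avg G f x ≤ avg G g x := by
  unfold avg
  gcongr with z hz
  exact h z (by simpa using hz)

lemma avg_nonneg {f : V → ℝ} (hf : ∀ z, 0 ≤ f z) (x : V) : 0 ≤ avg G f x :=
  div_nonneg (Finset.sum_nonneg fun z _ => hf z) (Nat.cast_nonneg _)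

lemma avg_const {x : V} (hx : 0 < G.degree x) (c : ℝ) : avg G (fun _ => c) x = c := by
  have : (G.degree x : ℝ) ≠ 0 := by positivity
  simp only [avg, Finset.sum_const, SimpleGraph.card_neighborFinset_eq_degree, nsmul_eq_mul]
  field_simp

lemma avg_finset_sum {ι : Type*} (s : Finset ι) (f : ι → V → ℝ) (x : V) :
    avg G (fun z => ∑ i ∈ s, f i z) x = ∑ i ∈ s, avg G (f i) x := by
  simp only [avg, Finset.sum_div]
  rw [Finset.sum_comm]

lemma abs_avg_le (f : V → ℝ) (x : V) : |avg G f x| ≤ avg G (fun z => |f z|) x := by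
  unfold avg
  rw [abs_div, Nat.abs_cast]
  gcongr
  exact Finset.abs_sum_le_sum_abs _ _

lemma tendsto_avg {ι : Type*} {l : Filter ι} {F : ι → V → ℝ} {f : V → ℝ}
    (h : ∀ z, Tendsto (fun i => F i z) l (𝓝 (f z))) (x : V) :
    Tendsto (fun i => avg G (F i) x) l (𝓝 (avg G f x)) :=
  (tendsto_finsetSum _ fun z _ => h z).div_const _

variable (G) in
open Classical in
/-- The probability that simple random walk from `x`, killed on `A`, is at `y` at time `n`, divided
by the degree of `y`. -/
def killedDensity (A : Set V) : ℕ → V → V → ℝ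
  | 0, x, y => if x = y ∧ x ∉ A then (G.degree y : ℝ)⁻¹ else 0
  | n + 1, x, y => if x ∈ A then 0 else avg G (fun z => killedDensity A n z y) x

lemma killedDensity_nonneg (A : Set V) (n : ℕ) (x y : V) : 0 ≤ killedDensity G A n x y := by
  induction n generalizing x with
  | zero => simp only [killedDensity]; split_ifs <;> positivity
  | succ n ih =>
    simp only [killedDensity]
    split_ifs
    · exact le_rfl
    · exact avg_nonneg (fun z => ih z) x

lemma killedDensity_of_mem {A : Set V} {x : V} (hx : x ∈ A) (n : ℕ) (y : V) :
    killedDensity G A n x y = 0 := by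
  cases n <;> simp [killedDensity, hx]

open Classical in
-- Decomposition at the last instead of the first step. Together with the defining recursion it
-- yields symmetry; dividing by the degree of the endpoint is what makes the base case symmetric.
lemma killedDensity_succ_right (A : Set V) (n : ℕ) (x y : V) :
    killedDensity G A (n + 1) x y =
      if y ∈ A then 0 else avg G (fun z => killedDensity G A n x z) y := by
  induction n generalizing x with
  | zero =>
    simp only [killedDensity]
    by_cases hx : x ∈ A
    · simp [hx, avg]
    by_cases hy : y ∈ A
    · have : ∀ z, ¬ (z = y ∧ z ∉ A) := fun z h => h.2 (h.1 ▸ hy)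
      simp [hy, this, avg]
    simp only [if_neg hx, if_neg hy]
    have e1 : ∀ z, (z = y ∧ z ∉ A) ↔ z = y := fun z => ⟨fun h => h.1, fun h => ⟨h, h ▸ hy⟩⟩
    have e2 : ∀ z, (x = z ∧ x ∉ A) ↔ x = z := fun z => ⟨fun h => h.1, fun h => ⟨h, hx⟩⟩
    simp only [avg, e1, e2, Finset.sum_ite_eq, Finset.sum_ite_eq', SimpleGraph.mem_neighborFinset,
      G.adj_comm y x]
    split_ifs
    · field_simp
    · simp
  | succ n ih =>
    rw [killedDensity]
    by_cases hx : x ∈ A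
    · simp [hx, killedDensity_of_mem hx, avg]
    rw [if_neg hx]
    simp only [ih]
    by_cases hy : y ∈ A
    · simp [hy, avg]
    simp only [if_neg hy]
    have : ∀ z, killedDensity G A (n + 1) x z = avg G (fun u => killedDensity G A n u z) x := by
      intro z
      rw [killedDensity, if_neg hx]
    simp only [this, avg, Finset.sum_div]
    rw [Finset.sum_comm]
    refine Finset.sum_congr rfl fun z _ => Finset.sum_congr rfl fun u _ => ?_
    rw [div_right_comm]

lemma killedDensity_symm (A : Set V) (n : ℕ) (x y : V) :
    killedDensity G A n x y = killedDensity G A n y x := by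
  induction n generalizing x y with
  | zero =>
    simp only [killedDensity]
    by_cases h : x = y
    · subst h; rfl
    · simp [h, Ne.symm h]
  | succ n ih =>
    rw [killedDensity, killedDensity_succ_right]
    simp only [ih]

variable (G) in
/-- The expected number of visits before time `N`, normalised by the degree. -/
def partialGreen (A : Set V) (N : ℕ) (x y : V) : ℝ :=
  ∑ n ∈ Finset.range N, killedDensity G A n x y

lemma partialGreen_nonneg (A : Set V) (N : ℕ) (x y : V) : 0 ≤ partialGreen G A N x y :=
  Finset.sum_nonneg fun n _ => killedDensity_nonneg A n x y

lemma partialGreen_of_mem {A : Set V} {x : V} (hx : x ∈ A) (N : ℕ) (y : V) :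
    partialGreen G A N x y = 0 :=
  Finset.sum_eq_zero fun n _ => killedDensity_of_mem hx n y

lemma partialGreen_mono (A : Set V) (x y : V) : Monotone fun N => partialGreen G A N x y :=
  fun _ _ h => Finset.sum_le_sum_of_subset_of_nonneg (Finset.range_mono h)
    fun n _ _ => killedDensity_nonneg A n x y

open Classical in
lemma partialGreen_succ {A : Set V} {x : V} (hx : x ∉ A) (N : ℕ) (y : V) :
    partialGreen G A (N + 1) x y =
      (if x = y then (G.degree y : ℝ)⁻¹ else 0) + avg G (fun z => partialGreen G A N z y) x := by
  unfold partialGreen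
  rw [Finset.sum_range_succ', avg_finset_sum, add_comm]
  congr 1
  · simp [killedDensity, hx]
  · refine Finset.sum_congr rfl fun n _ => ?_
    rw [killedDensity, if_neg hx]

/-- Maximum principle: away from `y` the function is an average, so its maximum is at `y`. -/
lemma partialGreen_le (hd : ∀ x, 0 < G.degree x) (A : Set V) (N : ℕ) (x y : V) :
    partialGreen G A N x y ≤ partialGreen G A N y y := by
  classical
  induction N generalizing x with
  | zero => simp [partialGreen]
  | succ N ih =>
    by_cases hxy : x = y
    · rw [hxy]
    by_cases hx : x ∈ A
    · rw [partialGreen_of_mem hx]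
      exact partialGreen_nonneg _ _ _ _
    · rw [partialGreen_succ hx, if_neg hxy, zero_add]
      calc avg G (fun z => partialGreen G A N z y) x ≤ avg G (fun _ => partialGreen G A N y y) x :=
            avg_mono fun z _ => ih z
        _ = partialGreen G A N y y := avg_const (hd x) _
        _ ≤ _ := partialGreen_mono A y y N.le_succ

/-- The walk reaches `A` from `y` along a fixed path with positive probability before it can return
too often. Quantitatively, a bound `(1 - ε) L + K` propagates along a path from `A` to `y`, and at
`y` it reads `L ≤ (1 - ε) L + K`. -/
lemma exists_partialGreen_le (hd : ∀ x, 0 < G.degree x) (hc : G.Connected) {A : Set V}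
    (hA : A.Nonempty) (y : V) : ∃ C, ∀ N, partialGreen G A N y y ≤ C := by
  classical
  obtain ⟨a, ha⟩ := hA
  set L : ℕ → ℝ := fun N => partialGreen G A N y y with hL
  have hL0 : ∀ N, 0 ≤ L N := fun N => partialGreen_nonneg _ _ _ _
  have key : ∀ x, G.Reachable a x → ∃ ε : ℝ, 0 < ε ∧ ∃ K : ℝ, ∀ N,
      partialGreen G A N x y ≤ (1 - ε) * L N + K := by
    intro x hx
    have hx' := (SimpleGraph.reachable_iff_reflTransGen a x).1 hx
    induction hx' with
    | refl => exact ⟨1, one_pos, 0, fun N => by rw [partialGreen_of_mem ha]; simp⟩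
    | @tail z x hz hzx ih =>
      obtain ⟨ε, hε, K, hK⟩ := ih ((SimpleGraph.reachable_iff_reflTransGen a z).2 hz)
      by_cases hxA : x ∈ A
      · exact ⟨1, one_pos, 0, fun N => by rw [partialGreen_of_mem hxA]; simp⟩
      have hdx : (0 : ℝ) < G.degree x := by exact_mod_cast hd x
      -- One neighbour of `x` obeys the improved bound and the other `degree x - 1` obey the trivial
      -- bound `L N`. The initial position contributes at most `1 / degree y`.
      refine ⟨ε / G.degree x, by positivity, K / G.degree x + (G.degree y : ℝ)⁻¹, fun N => ?_⟩
      have hzmem : z ∈ G.neighborFinset x := by simpa using hzx.symm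
      have hcard : ((G.neighborFinset x).erase z).card = G.degree x - 1 := by
        rw [Finset.card_erase_of_mem hzmem, SimpleGraph.card_neighborFinset_eq_degree]
      calc partialGreen G A N x y ≤ partialGreen G A (N + 1) x y := partialGreen_mono A x y N.le_succ
        _ ≤ (G.degree y : ℝ)⁻¹ + avg G (fun z => partialGreen G A N z y) x := by
            rw [partialGreen_succ hxA]
            gcongr
            split_ifs
            · exact le_rfl
            · positivity
        _ ≤ (G.degree y : ℝ)⁻¹ +
            (((1 - ε) * L N + K) + (G.degree x - 1) * L N) / G.degree x := by
            unfold avg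
            gcongr
            rw [← Finset.add_sum_erase _ _ hzmem]
            refine add_le_add (hK N) ?_
            refine (Finset.sum_le_card_nsmul _ _ (L N)
              fun u _ => partialGreen_le hd A N u y).trans ?_
            rw [hcard, nsmul_eq_mul, Nat.cast_pred (hd x)]
        _ = _ := by field_simp; ring
  obtain ⟨ε, hε, K, hK⟩ := key y (hc.preconnected a y)
  refine ⟨K / ε, fun N => ?_⟩
  rw [le_div_iff₀ hε]
  have : L N ≤ (1 - ε) * L N + K := hK N
  change L N * ε ≤ K
  linarith

lemma summable_killedDensity (hd : ∀ x, 0 < G.degree x) (hc : G.Connected) {A : Set V}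
    (hA : A.Nonempty) (x y : V) : Summable fun n => killedDensity G A n x y := by
  obtain ⟨C, hC⟩ := exists_partialGreen_le hd hc hA y
  exact summable_of_sum_range_le (fun n => killedDensity_nonneg A n x y)
    fun N => (partialGreen_le hd A N x y).trans (hC N)

variable (G) in
/-- The Green function of the walk killed on `A`, normalised by the degree. -/
def greenFn (A : Set V) (x y : V) : ℝ := ∑' n, killedDensity G A n x y

lemma greenFn_nonneg (A : Set V) (x y : V) : 0 ≤ greenFn G A x y :=
  tsum_nonneg fun n => killedDensity_nonneg A n x y

lemma greenFn_symm (A : Set V) (x y : V) : greenFn G A x y = greenFn G A y x :=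
  tsum_congr fun n => killedDensity_symm A n x y

lemma greenFn_of_mem {A : Set V} {x : V} (hx : x ∈ A) (y : V) : greenFn G A x y = 0 := by
  simp [greenFn, killedDensity_of_mem hx]

lemma tendsto_partialGreen (hd : ∀ x, 0 < G.degree x) (hc : G.Connected) {A : Set V}
    (hA : A.Nonempty) (x y : V) :
    Tendsto (fun N => partialGreen G A N x y) atTop (𝓝 (greenFn G A x y)) :=
  (summable_killedDensity hd hc hA x y).hasSum.tendsto_sum_nat

lemma greenFn_le (hd : ∀ x, 0 < G.degree x) (hc : G.Connected) {A : Set V}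
    (hA : A.Nonempty) (x y : V) : greenFn G A x y ≤ greenFn G A y y :=
  le_of_tendsto_of_tendsto' (tendsto_partialGreen hd hc hA x y)
    (tendsto_partialGreen hd hc hA y y) fun N => partialGreen_le hd A N x y

open Classical in
lemma greenFn_eq (hd : ∀ x, 0 < G.degree x) (hc : G.Connected) {A : Set V}
    (hA : A.Nonempty) {x : V} (hx : x ∉ A) (y : V) :
    greenFn G A x y =
      (if x = y then (G.degree y : ℝ)⁻¹ else 0) + avg G (fun z => greenFn G A z y) x := by
  have h1 := (tendsto_add_atTop_iff_nat 1).2 (tendsto_partialGreen hd hc hA x y)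
  simp only [partialGreen_succ hx] at h1
  exact tendsto_nhds_unique h1 (tendsto_const_nhds.add
    (tendsto_avg (fun z => tendsto_partialGreen hd hc hA z y) x))

lemma greenFn_pos (hd : ∀ x, 0 < G.degree x) (hc : G.Connected) {A : Set V}
    (hA : A.Nonempty) {x : V} (hx : x ∉ A) : 0 < greenFn G A x x := by
  rw [greenFn_eq hd hc hA hx, if_pos rfl]
  have : (0 : ℝ) < G.degree x := by exact_mod_cast hd x
  have := avg_nonneg (G := G) (fun z => greenFn_nonneg (G := G) A z x) x
  positivity

/-! ### Bounded harmonic functions on recurrent graphs -/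

variable (G) in
open Classical in
/-- The probability that simple random walk from `x` does not hit `b` up to time `n`. -/
def survival (b : V) : ℕ → V → ℝ
  | 0, x => if x = b then 0 else 1
  | n + 1, x => if x = b then 0 else avg G (survival b n) x

lemma survival_nonneg (b : V) (n : ℕ) (x : V) : 0 ≤ survival G b n x := by
  induction n generalizing x with
  | zero => simp only [survival]; split_ifs <;> norm_num
  | succ n ih =>
    simp only [survival]
    split_ifs
    · exact le_rfl
    · exact avg_nonneg ih x

variable (G) in
/-- Simple random walk hits every vertex almost surely. -/
def HitsAll : Prop := ∀ b x, Tendsto (fun n => survival G b n x) atTop (𝓝 0)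

/-- A bounded function that is harmonic off a nonempty set on which it is constant is constant. -/
lemma HitsAll.eq_of_harmonic (hG : HitsAll G) (hd : ∀ x, 0 < G.degree x) {S : Set V} {b : V}
    (hb : b ∈ S) {f : V → ℝ} {C c : ℝ} (hC : ∀ x, |f x| ≤ C) (hS : ∀ x ∈ S, f x = c)
    (hf : ∀ x ∉ S, avg G f x = f x) (x : V) : f x = c := by
  have hc : |c| ≤ C := hS b hb ▸ hC b
  have hC0 : 0 ≤ C := (abs_nonneg _).trans hc
  -- Following the walk until it enters `S`, the deviation from `c` is carried only by paths that
  -- have not yet hit `b`.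
  have key : ∀ n x, |f x - c| ≤ 2 * C * survival G b n x := by
    intro n
    induction n with
    | zero =>
      intro x
      by_cases hx : x = b
      · simp [survival, hx, hS b hb]
      · simp only [survival, if_neg hx, mul_one]
        calc |f x - c| ≤ |f x| + |c| := abs_sub _ _
          _ ≤ 2 * C := by linarith [hC x]
    | succ n ih =>
      intro x
      by_cases hx : x ∈ S
      · rw [hS x hx, sub_self, abs_zero]
        exact mul_nonneg (by linarith) (survival_nonneg _ _ _)
      · have hxb : x ≠ b := fun h => hx (h ▸ hb)
        simp only [survival, if_neg hxb]
        rw [← avg_mul_left]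
        calc |f x - c| = |avg G (fun z => f z - c) x| := by
              rw [avg_sub, hf x hx, avg_const (hd x)]
          _ ≤ avg G (fun z => |f z - c|) x := abs_avg_le _ _
          _ ≤ _ := avg_mono fun z _ => ih z
  have h2 : |f x - c| ≤ 2 * C * 0 :=
    ge_of_tendsto' ((hG b x).const_mul (2 * C)) fun n => key n x
  rw [mul_zero] at h2
  exact sub_eq_zero.1 (abs_eq_zero.1 (le_antisymm h2 (abs_nonneg _)))

/-! ### Green function identities on recurrent graphs -/

variable (hG : HitsAll G) (hd : ∀ x, 0 < G.degree x) (hc : G.Connected)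
include hG hd hc

/-- The walk enters `o` from a neighbour `z` with probability `1 / deg z` at each visit to `z`, so
the sum is the probability of ever hitting `o`. -/
lemma sum_greenFn_neighbor {o x : V} (hx : x ≠ o) :
    ∑ z ∈ G.neighborFinset o, greenFn G {o} x z = 1 := by
  classical
  set φ : V → ℝ := fun x => ∑ z ∈ G.neighborFinset o, greenFn G {o} x z with hφ
  have hne : ({o} : Set V).Nonempty := Set.singleton_nonempty o
  have hφo : φ o = 0 := Finset.sum_eq_zero fun z _ => greenFn_of_mem (Set.mem_singleton o) z
  have hφx : ∀ x, x ≠ o → φ x = (if G.Adj o x then (G.degree x : ℝ)⁻¹ else 0) + avg G φ x := by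
    intro x hx
    simp only [hφ]
    rw [avg_finset_sum]
    rw [Finset.sum_congr rfl fun z _ => greenFn_eq hd hc hne (x := x) (A := {o}) hx z,
      Finset.sum_add_distrib]
    simp
  -- Changing the value at `o` from 0 to 1 absorbs the source terms of the Green functions at the
  -- neighbours of `o`.
  have := hG.eq_of_harmonic hd (S := {o}) (b := o) rfl (f := fun x => if x = o then 1 else φ x)
    (C := 1 + ∑ z ∈ G.neighborFinset o, greenFn G {o} z z) (c := 1) ?_ (by simp) ?_ x
  · simpa [hx] using this
  · intro x
    have h0 : ∀ z, 0 ≤ greenFn G {o} z z := fun z => greenFn_nonneg _ _ _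
    have h1 : φ x ≤ ∑ z ∈ G.neighborFinset o, greenFn G {o} z z :=
      Finset.sum_le_sum fun z _ => greenFn_le hd hc hne x z
    have h2 : 0 ≤ φ x := Finset.sum_nonneg fun z _ => greenFn_nonneg _ _ _
    split_ifs
    · rw [abs_one]; linarith
    · rw [abs_of_nonneg h2]; linarith
  · intro x hx
    have hx : x ≠ o := hx
    simp only [if_neg hx]
    have e : ∀ z, (if z = o then 1 else φ z) = (if z = o then 1 else 0) + φ z := by
      intro z
      split_ifs with h
      · rw [h, hφo, add_zero]
      · rw [zero_add]
    simp only [e]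
    rw [avg_add, hφx x hx]
    congr 1
    simp only [avg, Finset.sum_ite_eq', SimpleGraph.mem_neighborFinset, G.adj_comm x o]
    split_ifs <;> simp

lemma avg_greenFn_root {o b : V} (hb : b ≠ o) :
    avg G (fun z => greenFn G {o} z b) o = (G.degree o : ℝ)⁻¹ := by
  have := sum_greenFn_neighbor hG hd hc hb
  simp only [avg, greenFn_symm {o} _ b, this, one_div]

/-- The kernel truncated at a vertex `b` is the Green function of the walk killed at `o`. -/
lemma greenFn_sub_eq {o b : V} (hb : b ≠ o) (y : V) :
    greenFn G {b} o o - greenFn G {b} y o = greenFn G {o} y b := by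
  classical
  have hne : ∀ v : V, ({v} : Set V).Nonempty := Set.singleton_nonempty
  -- Both Green functions produce the same source `1 / deg o` at `o`, so `f` is harmonic there too.
  -- Hence `f` is constant, with value `f o = 0`.
  set f : V → ℝ := fun y => greenFn G {b} o o - greenFn G {b} y o - greenFn G {o} y b with hf
  have hfo : f o = 0 := by simp [hf, greenFn_of_mem]
  have hob : o ∉ ({b} : Set V) := fun h => hb h.symm
  have key := hG.eq_of_harmonic hd (S := {b}) (b := b) rfl (f := f)
    (C := 2 * greenFn G {b} o o + greenFn G {o} b b) (c := f b) ?_ (by simp) ?_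
  · have h1 := (key y).trans ((key o).symm.trans hfo)
    simp only [hf] at h1
    linarith
  · intro x
    rw [abs_le]
    have h1 := greenFn_le hd hc (hne b) x o
    have h2 := greenFn_le hd hc (hne o) x b
    have h3 := greenFn_nonneg (G := G) {b} x o
    have h4 := greenFn_nonneg (G := G) {o} x b
    have h5 := greenFn_nonneg (G := G) {b} o o
    simp only [hf]
    constructor <;> linarith
  · intro x hx
    simp only [hf]
    rw [avg_sub, avg_sub, avg_const (hd x)]
    by_cases hxo : x = o
    · subst hxo
      have e1 := greenFn_eq hd hc (hne b) hx x
      rw [if_pos rfl] at e1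
      rw [avg_greenFn_root hG hd hc hb, greenFn_of_mem (Set.mem_singleton x) b]
      linarith
    · have e1 := greenFn_eq hd hc (hne b) hx o
      have e2 := greenFn_eq hd hc (hne o) (x := x) hxo b
      rw [if_neg hxo, zero_add] at e1
      rw [if_neg (show x ≠ b from hx), zero_add] at e2
      rw [← e1, ← e2]

lemma greenFn_singleton_comm {o b : V} (hb : b ≠ o) :
    greenFn G {o} b b = greenFn G {b} o o := by
  rw [← greenFn_sub_eq hG hd hc hb b, greenFn_of_mem (Set.mem_singleton b), sub_zero]

/-- Divided by `g_o(b,b) = g_b(o,o)`, the two terms are the probabilities of reaching `b` before `o`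
and `o` before `b`. -/
lemma greenFn_add_greenFn {o b : V} (hb : b ≠ o) (z : V) :
    greenFn G {o} z b + greenFn G {b} z o = greenFn G {o} b b := by
  have hne : ∀ v : V, ({v} : Set V).Nonempty := Set.singleton_nonempty
  refine hG.eq_of_harmonic hd (S := {o, b}) (b := b) (by simp)
    (f := fun z => greenFn G {o} z b + greenFn G {b} z o)
    (C := greenFn G {b} o o + greenFn G {o} b b) ?_ ?_ ?_ z
  · intro x
    have h1 := greenFn_le hd hc (hne b) x o
    have h2 := greenFn_le hd hc (hne o) x b
    have h3 := greenFn_nonneg (G := G) {b} x o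
    have h4 := greenFn_nonneg (G := G) {o} x b
    rw [abs_of_nonneg (by linarith)]
    linarith
  · rintro x (rfl | rfl)
    · rw [greenFn_of_mem (Set.mem_singleton x), zero_add, greenFn_singleton_comm hG hd hc hb]
    · rw [greenFn_of_mem (Set.mem_singleton x), add_zero]
  · intro x hx
    have hxo : x ≠ o := fun h => hx (Or.inl h)
    have hxb : x ≠ b := fun h => hx (Or.inr h)
    have e1 := greenFn_eq hd hc (hne b) (x := x) hxb o
    have e2 := greenFn_eq hd hc (hne o) (x := x) hxo b
    rw [if_neg hxo, zero_add] at e1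
    rw [if_neg hxb, zero_add] at e2
    rw [avg_add, ← e1, ← e2]

end Green

/-! ### Simple random walk and potential kernels -/

section Walk

set_option linter.unusedSectionVars false

variable {V : Type} {G : SimpleGraph V} [G.LocallyFinite]

lemma deg_eq_degree (x : V) : deg G x = G.degree x := by
  rw [deg, Set.ncard_eq_toFinset_card', SimpleGraph.degree, SimpleGraph.neighborFinset]

lemma tsum_srwStep_mul (x : V) (f : V → ℝ≥0∞) :
    ∑' y, srwStep G x y * f y = ∑ y ∈ G.neighborFinset x, (G.degree x : ℝ≥0∞)⁻¹ * f y := by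
  rw [tsum_eq_sum (s := G.neighborFinset x)]
  · refine Finset.sum_congr rfl fun y hy => ?_
    rw [srwStep, if_pos (by simpa using hy), deg_eq_degree]
  · intro y hy
    rw [srwStep, if_neg (by simpa using hy), zero_mul]

lemma tsum_srwStep_mul_ofReal {x : V} (hx : 0 < G.degree x) {g : V → ℝ} (hg : ∀ y, 0 ≤ g y) :
    ∑' y, srwStep G x y * ENNReal.ofReal (g y) = ENNReal.ofReal (avg G g x) := by
  rw [tsum_srwStep_mul, avg, Finset.sum_div,
    ENNReal.ofReal_sum_of_nonneg fun y _ => div_nonneg (hg y) (Nat.cast_nonneg _)]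
  refine Finset.sum_congr rfl fun y _ => ?_
  rw [ENNReal.ofReal_div_of_pos (by exact_mod_cast hx), ENNReal.ofReal_natCast, mul_comm]
  rfl

lemma tsum_srwStep {x : V} (hx : 0 < G.degree x) : ∑' y, srwStep G x y = 1 := by
  have := tsum_srwStep_mul_ofReal hx (g := fun _ => 1) fun _ => zero_le_one
  simpa [avg_const hx] using this

variable [Countable V] [MeasurableSpace V] [DiscreteMeasurableSpace V]

lemma chainLaw_srwStep_killed (hd : ∀ x, 0 < G.degree x) (A : Set V) (n : ℕ) (x y : V) :
    chainLaw (srwStep G) x {ξ | ξ n = y ∧ ∀ m ≤ n, ξ m ∉ A} =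
      ENNReal.ofReal (G.degree y * killedDensity G A n x y) := by
  classical
  have hm : ∀ n, MeasurableSet {ξ : ℕ → V | ξ n = y ∧ ∀ m ≤ n, ξ m ∉ A} := by
    intro n
    have : {ξ : ℕ → V | ξ n = y ∧ ∀ m ≤ n, ξ m ∉ A} =
        {ξ : ℕ → V | ξ n ∈ ({y} : Set V)} ∩ ⋂ m, ⋂ _ : m ≤ n, {ξ : ℕ → V | ξ m ∈ Aᶜ} := by
      ext; simp
    rw [this]
    exact (measurableSet_path_mem n {y}).inter
      (MeasurableSet.iInter fun m => MeasurableSet.iInter fun _ => measurableSet_path_mem m _)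
  have hdy : (G.degree y : ℝ) ≠ 0 := by exact_mod_cast (hd y).ne'
  induction n generalizing x with
  | zero =>
    simp only [killedDensity]
    split_ifs with h
    · rw [mul_inv_cancel₀ hdy, ENNReal.ofReal_one]
      refine (mem_ae_iff_prob_eq_one (hm 0)).1 ?_
      filter_upwards [chainLaw_start (srwStep G) x] with ξ hξ
      refine ⟨hξ.trans h.1, fun m hm => ?_⟩
      obtain rfl : m = 0 := by omega
      rw [hξ]
      exact h.2
    · rw [mul_zero, ENNReal.ofReal_zero]
      refine measure_mono_null (t := {ξ | ¬ ξ 0 = x}) ?_ (chainLaw_start _ x)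
      rintro ξ ⟨h1, h2⟩ h3
      have h3 : ξ 0 = x := h3
      exact h ⟨h3.symm.trans h1, h3 ▸ h2 0 le_rfl⟩
  | succ n ih =>
    rw [chainLaw_apply _ _ (tsum_srwStep (hd x)) (hm _)]
    simp only [killedDensity]
    split_ifs with h
    · have : consPath x ⁻¹' {ξ | ξ (n + 1) = y ∧ ∀ m ≤ n + 1, ξ m ∉ A} = ∅ := by
        ext ξ
        simp only [Set.mem_preimage, Set.mem_empty_iff_false, iff_false]
        exact fun H => H.2 0 (Nat.zero_le _) h
      simp [this]
    · have : consPath x ⁻¹' {ξ | ξ (n + 1) = y ∧ ∀ m ≤ n + 1, ξ m ∉ A} =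
          {ξ | ξ n = y ∧ ∀ m ≤ n, ξ m ∉ A} := by
        ext ξ
        constructor
        · exact fun H => ⟨H.1, fun m hm => H.2 (m + 1) (by omega)⟩
        · refine fun H => ⟨H.1, fun m hm => ?_⟩
          cases m with
          | zero => exact h
          | succ m => exact H.2 m (by omega)
      rw [this, ← avg_mul_left, ← tsum_srwStep_mul_ofReal (hd x) fun z =>
        mul_nonneg (Nat.cast_nonneg _) (killedDensity_nonneg A n z y)]
      simp only [ih]

lemma lt_hitTime_iff (A : Finset V) (ξ : ℕ → V) (n : ℕ) :
    (n : ℕ∞) < hitTime A ξ ↔ ∀ m ≤ n, ξ m ∉ (A : Set V) := by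
  rw [← not_iff_not, not_lt, hitTime]
  push Not
  constructor
  · intro h
    by_contra! h2
    have : ((n + 1 : ℕ) : ℕ∞) ≤ ⨅ (k : ℕ) (_ : ξ k ∈ A), (k : ℕ∞) := by
      refine le_iInf₂ fun k hk => ?_
      have : n < k := by
        by_contra h3
        exact h2 k (not_lt.1 h3) hk
      exact_mod_cast this
    have h3 := this.trans h
    norm_cast at h3
    omega
  · rintro ⟨m, hm, h⟩
    exact (iInf₂_le m h).trans (by exact_mod_cast hm)

lemma green_eq (hd : ∀ x, 0 < G.degree x) (hc : G.Connected) {A : Finset V}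
    (hA : A.Nonempty) (x y : V) :
    green G A x y = ENNReal.ofReal (G.degree y * greenFn G A x y) := by
  classical
  have hm : ∀ n : ℕ, MeasurableSet {ξ : ℕ → V | ξ n = y ∧ ∀ m ≤ n, ξ m ∉ (A : Set V)} := by
    intro n
    have : {ξ : ℕ → V | ξ n = y ∧ ∀ m ≤ n, ξ m ∉ (A : Set V)} =
        {ξ : ℕ → V | ξ n ∈ ({y} : Set V)} ∩
          ⋂ m, ⋂ _ : m ≤ n, {ξ : ℕ → V | ξ m ∈ (A : Set V)ᶜ} := by
      ext; simp
    rw [this]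
    exact (measurableSet_path_mem n {y}).inter
      (MeasurableSet.iInter fun m => MeasurableSet.iInter fun _ => measurableSet_path_mem m _)
  have h1 : ∀ (n : ℕ) (ξ : ℕ → V),
      (if (n : ℕ∞) < hitTime A ξ ∧ ξ n = y then (1 : ℝ≥0∞) else 0) =
      Set.indicator {ξ : ℕ → V | ξ n = y ∧ ∀ m ≤ n, ξ m ∉ (A : Set V)} 1 ξ := by
    intro n ξ
    rw [Set.indicator_apply]
    refine if_congr ?_ rfl rfl
    rw [lt_hitTime_iff]
    exact and_comm
  have hs := summable_killedDensity hd hc (A := (A : Set V)) hA x y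
  have hA' : (A : Set V).Nonempty := hA
  unfold green
  simp only [h1]
  rw [lintegral_tsum fun n => (measurable_one.indicator (hm n)).aemeasurable]
  simp only [lintegral_indicator_one (hm _)]
  simp only [chainLaw_srwStep_killed hd]
  rw [greenFn, ← tsum_mul_left, ENNReal.ofReal_tsum_of_nonneg]
  · exact fun n => mul_nonneg (Nat.cast_nonneg _) (killedDensity_nonneg _ n x y)
  · exact hs.mul_left _

lemma truncatedKernel_eq (hd : ∀ x, 0 < G.degree x) (hc : G.Connected) {A : Finset V}
    (hA : A.Nonempty) (x y : V) :
    truncatedKernel G A x y = greenFn G A y y - greenFn G A x y := by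
  have hdy : (G.degree y : ℝ) ≠ 0 := by exact_mod_cast (hd y).ne'
  have : ∀ x, greenNorm G A x y = greenFn G A x y := by
    intro x
    rw [greenNorm, green_eq hd hc hA, deg_eq_degree, ENNReal.toReal_ofReal
      (mul_nonneg (Nat.cast_nonneg _) (greenFn_nonneg _ x y)), mul_div_cancel_left₀ _ hdy]
  rw [truncatedKernel, this, this]

lemma chainLaw_srwStep_survival (hd : ∀ x, 0 < G.degree x) (b : V) (n : ℕ) (x : V) :
    chainLaw (srwStep G) x {ξ | ∀ m ≤ n, ξ m ≠ b} = ENNReal.ofReal (survival G b n x) := by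
  classical
  have hm : ∀ n, MeasurableSet {ξ : ℕ → V | ∀ m ≤ n, ξ m ≠ b} := by
    intro n
    have : {ξ : ℕ → V | ∀ m ≤ n, ξ m ≠ b} =
        ⋂ m, ⋂ _ : m ≤ n, {ξ : ℕ → V | ξ m ∈ ({b} : Set V)ᶜ} := by
      ext; simp
    rw [this]
    exact MeasurableSet.iInter fun m => MeasurableSet.iInter fun _ => measurableSet_path_mem m _
  induction n generalizing x with
  | zero =>
    simp only [survival]
    split_ifs with h
    · rw [ENNReal.ofReal_zero]
      refine measure_mono_null (t := {ξ | ¬ ξ 0 = x}) ?_ (chainLaw_start _ x)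
      intro ξ hξ h'
      exact hξ 0 le_rfl ((show ξ 0 = x from h').trans h)
    · rw [ENNReal.ofReal_one]
      refine (mem_ae_iff_prob_eq_one (hm 0)).1 ?_
      filter_upwards [chainLaw_start (srwStep G) x] with ξ hξ m hm
      obtain rfl : m = 0 := by omega
      rwa [hξ]
  | succ n ih =>
    rw [chainLaw_apply _ _ (tsum_srwStep (hd x)) (hm _)]
    simp only [survival]
    split_ifs with h
    · have : consPath x ⁻¹' {ξ | ∀ m ≤ n + 1, ξ m ≠ b} = ∅ := by
        ext ξ
        simp only [Set.mem_preimage, Set.mem_empty_iff_false, iff_false]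
        exact fun H => H 0 (Nat.zero_le _) h
      simp [this]
    · have : consPath x ⁻¹' {ξ | ∀ m ≤ n + 1, ξ m ≠ b} = {ξ | ∀ m ≤ n, ξ m ≠ b} := by
        ext ξ
        constructor
        · exact fun H m hm => H (m + 1) (by omega)
        · intro H m hm
          cases m with
          | zero => exact h
          | succ m => exact H m (by omega)
      rw [this, ← tsum_srwStep_mul_ofReal (hd x) fun z => survival_nonneg b n z]
      simp only [ih]

lemma survival_antitone (hd : ∀ x, 0 < G.degree x) (b x : V) :
    Antitone fun n => survival G b n x := by
  intro n m hnm
  have h := measure_mono (μ := chainLaw (srwStep G) x)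
    (show {ξ : ℕ → V | ∀ k ≤ m, ξ k ≠ b} ⊆ {ξ | ∀ k ≤ n, ξ k ≠ b} from
      fun ξ hξ k hk => hξ k (hk.trans hnm))
  rw [chainLaw_srwStep_survival hd, chainLaw_srwStep_survival hd] at h
  exact (ENNReal.ofReal_le_ofReal_iff (survival_nonneg _ _ _)).1 h

/-- The average is the probability of not returning to `b` within `n + 1` steps. -/
lemma Recurrent.tendsto_avg_survival (hR : Recurrent G) (hd : ∀ x, 0 < G.degree x) (b : V) :
    Tendsto (fun n => avg G (survival G b n) b) atTop (𝓝 0) := by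
  set E : ℕ → Set (ℕ → V) := fun n => {ξ | ∀ m ≤ n, ξ (m + 1) ≠ b} with hE
  have hm : ∀ n, MeasurableSet (E n) := by
    intro n
    have : E n = ⋂ m, ⋂ _ : m ≤ n, {ξ : ℕ → V | ξ (m + 1) ∈ ({b} : Set V)ᶜ} := by
      ext; simp [hE]
    rw [this]
    exact MeasurableSet.iInter fun m => MeasurableSet.iInter fun _ => measurableSet_path_mem _ _
  have hp : ∀ n, chainLaw (srwStep G) b (E n) = ENNReal.ofReal (avg G (survival G b n) b) := by
    intro n
    rw [chainLaw_apply _ _ (tsum_srwStep (hd b)) (hm _),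
      ← tsum_srwStep_mul_ofReal (hd b) fun z => survival_nonneg b n z]
    refine tsum_congr fun y => ?_
    rw [← chainLaw_srwStep_survival hd]
    rfl
  have hanti : Antitone E := fun n m hnm ξ hξ k hk => hξ k (hk.trans hnm)
  have h0 : chainLaw (srwStep G) b (⋂ n, E n) = 0 := by
    refine measure_mono_null ?_ (hR b)
    intro ξ hξ h
    obtain ⟨n, hn, hξn⟩ := h
    obtain ⟨k, rfl⟩ : ∃ k, n = k + 1 := ⟨n - 1, by omega⟩
    exact Set.mem_iInter.1 hξ k k le_rfl hξn
  have h1 := tendsto_measure_iInter_atTop (μ := chainLaw (srwStep G) b)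
    (fun n => (hm n).nullMeasurableSet) hanti ⟨0, measure_ne_top _ _⟩
  rw [h0] at h1
  have h2 := (ENNReal.tendsto_toReal ENNReal.zero_ne_top).comp h1
  simp only [ENNReal.toReal_zero] at h2
  refine h2.congr fun n => ?_
  simp only [Function.comp, hp]
  exact ENNReal.toReal_ofReal (avg_nonneg (survival_nonneg b n) b)

/-- The probability of never hitting `b` is nonnegative, vanishes at `b`, and is harmonic
everywhere; harmonicity at `b` is recurrence. By the minimum principle its zeros spread along edges.
-/
lemma Recurrent.hitsAll (hR : Recurrent G) (hd : ∀ x, 0 < G.degree x) (hc : G.Connected) :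
    HitsAll G := by
  classical
  intro b
  set e : V → ℝ := fun x => ⨅ n, survival G b n x with he
  have hlim : ∀ x, Tendsto (fun n => survival G b n x) atTop (𝓝 (e x)) := fun x =>
    tendsto_atTop_ciInf (survival_antitone hd b x)
      ⟨0, by rintro _ ⟨n, rfl⟩; exact survival_nonneg b n x⟩
  have he0 : ∀ x, 0 ≤ e x := fun x => ge_of_tendsto' (hlim x) fun n => survival_nonneg b n x
  have heb : e b = 0 := by
    refine tendsto_nhds_unique (hlim b) ?_
    have : ∀ n, survival G b n b = 0 := fun n => by cases n <;> simp [survival]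
    simp [this]
  have havg : ∀ x, avg G e x = e x := by
    intro x
    by_cases hx : x = b
    · subst hx
      rw [heb]
      exact tendsto_nhds_unique (tendsto_avg hlim x) (hR.tendsto_avg_survival hd x)
    · have h1 := (tendsto_add_atTop_iff_nat 1).2 (hlim x)
      simp only [survival, if_neg hx] at h1
      exact tendsto_nhds_unique (tendsto_avg hlim x) h1
  have hzero : ∀ x, e x = 0 := by
    intro x
    have hr := (SimpleGraph.reachable_iff_reflTransGen b x).1 (hc.preconnected b x)
    induction hr with
    | refl => exact heb
    | @tail z x _ hzx ih =>
      have h1 : avg G e z = 0 := (havg z).trans ih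
      have hdz : (G.degree z : ℝ) ≠ 0 := by exact_mod_cast (hd z).ne'
      rw [avg, div_eq_zero_iff, or_iff_left hdz,
        Finset.sum_eq_zero_iff_of_nonneg fun u _ => he0 u] at h1
      exact h1 x (by simpa using hzx)
  intro x
  rw [← hzero x]
  exact hlim x

end Walk

/-! ### The potential kernel as a limit of killed Green functions -/

section Kernel

set_option linter.unusedSectionVars false

variable {V : Type} {G : SimpleGraph V}

lemma finite_ball [G.LocallyFinite] (hc : G.Connected) (o : V) (r : ℕ) : {v | G.dist o v ≤ r}.Finite := by
  induction r with
  | zero =>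
    refine (Set.finite_singleton o).subset fun v hv => ?_
    have : G.dist o v = 0 := by simpa using hv
    exact ((hc.dist_eq_zero_iff).1 this).symm
  | succ r ih =>
    refine (ih.union (ih.biUnion fun u _ => (G.neighborFinset u).finite_toSet)).subset ?_
    intro v hv
    rcases Nat.lt_or_ge (G.dist o v) (r + 1) with h | h
    · exact Or.inl (Nat.lt_succ_iff.1 h)
    · right
      have hv : G.dist o v = r + 1 := le_antisymm hv h
      obtain ⟨p, hp⟩ := hc.exists_walk_length_eq_dist v o
      rw [SimpleGraph.dist_comm, hv] at hp
      cases p with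
      | nil => simp at hp
      | @cons _ u _ huv q =>
        simp only [SimpleGraph.Walk.length_cons] at hp
        refine Set.mem_iUnion₂.2 ⟨u, ?_, by simpa using huv.symm⟩
        have := SimpleGraph.dist_le q
        rw [SimpleGraph.dist_comm] at this
        exact this.trans (by omega)

lemma GoesToInfinity.reroot (hc : G.Connected) {o : V} {A : ℕ → Finset V}
    (h : GoesToInfinity G o A) (o' : V) : GoesToInfinity G o' A := by
  intro r
  filter_upwards [h (r + G.dist o o')] with n hn v hv
  have h1 := hn v hv
  have h2 := hc.dist_triangle (u := o) (v := o') (w := v)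
  omega

variable [Countable V] [MeasurableSpace V] [DiscreteMeasurableSpace V]

lemma IsPotentialKernel.reroot (hc : G.Connected) {o : V} {a : V → V → ℝ}
    (h : IsPotentialKernel G o a) (o' : V) : IsPotentialKernel G o' a :=
  fun A hA hA' => h A hA (hA'.reroot hc o)

variable [G.LocallyFinite]

variable {a : V → V → ℝ} {o : V}

/-- Singletons suffice as truncation sets, and on a countable vertex set the cofinite filter is
tested by sequences; finite balls make these sequences go to infinity. -/
lemma IsPotentialKernel.tendsto_cofinite (h : IsPotentialKernel G o a)
    (hd : ∀ x, 0 < G.degree x) (hc : G.Connected) (x y : V) :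
    Tendsto (fun b => greenFn G {b} y y - greenFn G {b} x y) cofinite (𝓝 (a x y)) := by
  have : (cofinite : Filter V).IsCountablyGenerated :=
    HasCountableBasis.isCountablyGenerated ⟨hasBasis_cofinite, Set.Countable.ofPred_finite⟩
  refine tendsto_of_seq_tendsto fun u hu => ?_
  have := h (fun n => {u n}) (fun n => Finset.singleton_nonempty _) ?_ x y
  · simp only [truncatedKernel_eq hd hc (Finset.singleton_nonempty _), Finset.coe_singleton]
      at this
    exact this
  · intro r
    have h1 := (finite_ball hc o r).compl_mem_cofinite
    filter_upwards [hu h1] with n hn v hv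
    rw [Finset.mem_singleton] at hv
    rw [hv]
    have h2 : ¬ G.dist o (u n) ≤ r := hn
    omega

variable [Infinite V] (h : IsPotentialKernel G o a) (hR : HitsAll G)
  (hd : ∀ x, 0 < G.degree x) (hc : G.Connected)
include h hR hd hc

/-- Truncating at a far vertex equals killing at `y`, by `greenFn_sub_eq`. The sign, harmonicity and
symmetrisation of `a` are all read off from this limit. -/
lemma IsPotentialKernel.tendsto_greenFn (x y : V) :
    Tendsto (fun b => greenFn G {y} x b) cofinite (𝓝 (a x y)) := by
  refine (h.tendsto_cofinite hd hc x y).congr' ?_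
  filter_upwards [(Set.finite_singleton y).compl_mem_cofinite] with b hb
  exact greenFn_sub_eq hR hd hc hb x

lemma IsPotentialKernel.nonneg (x y : V) : 0 ≤ a x y :=
  ge_of_tendsto' (h.tendsto_greenFn hR hd hc x y) fun _ => greenFn_nonneg _ _ _

lemma IsPotentialKernel.self (x : V) : a x x = 0 := by
  refine tendsto_nhds_unique (h.tendsto_greenFn hR hd hc x x) ?_
  simp only [greenFn_of_mem (Set.mem_singleton x)]
  exact tendsto_const_nhds

lemma IsPotentialKernel.add_swap {x y : V} (hxy : x ≠ y) :
    a x y + a y x = greenFn G {y} x x := by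
  refine tendsto_nhds_unique
    ((h.tendsto_greenFn hR hd hc x y).add (h.tendsto_greenFn hR hd hc y x)) ?_
  have : ∀ b, greenFn G {y} x b + greenFn G {x} y b = greenFn G {y} x x := by
    intro b
    rw [greenFn_symm _ x, greenFn_symm _ y, greenFn_add_greenFn hR hd hc hxy]
  simp only [this]
  exact tendsto_const_nhds

lemma IsPotentialKernel.avg_eq {x y : V} (hxy : x ≠ y) : avg G (fun z => a z y) x = a x y := by
  classical
  refine tendsto_nhds_unique (tendsto_avg (fun z => h.tendsto_greenFn hR hd hc z y) x) ?_
  refine (h.tendsto_greenFn hR hd hc x y).congr' ?_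
  filter_upwards [(Set.finite_singleton x).compl_mem_cofinite] with b hb
  have h1 := greenFn_eq hd hc (Set.singleton_nonempty y) (x := x) hxy b
  rw [if_neg (Ne.symm hb), zero_add] at h1
  exact h1

lemma IsPotentialKernel.avg_self (y : V) :
    avg G (fun z => a z y) y = (G.degree y : ℝ)⁻¹ := by
  refine tendsto_nhds_unique (tendsto_avg (fun z => h.tendsto_greenFn hR hd hc z y) y) ?_
  refine tendsto_const_nhds.congr' ?_
  filter_upwards [(Set.finite_singleton y).compl_mem_cofinite] with b hb
  exact (avg_greenFn_root hR hd hc hb).symm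

end Kernel

/-! ### The conditioned random walk -/

section Conditioned

set_option linter.unusedSectionVars false

variable {V : Type} {G : SimpleGraph V} [Countable V] [MeasurableSpace V]
  [DiscreteMeasurableSpace V] [G.LocallyFinite] {a : V → V → ℝ} {o : V}
  (h : IsPotentialKernel G o a) (hR : HitsAll G) (hd : ∀ x, 0 < G.degree x) (hc : G.Connected)
  [Infinite V]
include h hR hd hc

lemma ne_root_of_pos {x : V} (hx : 0 < a x o) : x ≠ o := by
  rintro rfl
  exact hx.ne' (h.self hR hd hc x)

lemma crwStep_of_pos {x : V} (hx : 0 < a x o) (y : V) :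
    crwStep G o a x y = ENNReal.ofReal (a y o / a x o) * srwStep G x y := by
  rw [crwStep, if_neg (ne_root_of_pos h hR hd hc hx)]

/-- The step out of the root has the shape of a Doob transform, with `deg o` in place of the
meaningless `1 / a(o,o)`. -/
lemma crwStep_root (y : V) :
    crwStep G o a o y = ENNReal.ofReal (G.degree o * a y o) * srwStep G o y := by
  rw [crwStep, if_pos rfl, srwStep, deg_eq_degree]
  have h0 : (G.degree o : ℝ≥0∞) ≠ 0 := by exact_mod_cast (hd o).ne'
  split_ifs
  · rw [ENNReal.ofReal_mul (Nat.cast_nonneg _), ENNReal.ofReal_natCast, mul_right_comm,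
      ENNReal.mul_inv_cancel h0 (ENNReal.natCast_ne_top _), one_mul]
  · rw [mul_zero]

lemma tsum_crwStep_of_pos {x : V} (hx : 0 < a x o) : ∑' y, crwStep G o a x y = 1 := by
  simp only [crwStep_of_pos h hR hd hc hx, mul_comm _ (srwStep G x _)]
  rw [tsum_srwStep_mul_ofReal (hd x) fun y => div_nonneg (h.nonneg hR hd hc y o) hx.le]
  have : ∀ y, a y o / a x o = (a x o)⁻¹ * a y o := fun y => by rw [div_eq_inv_mul]
  simp only [this]
  rw [avg_mul_left, h.avg_eq hR hd hc (ne_root_of_pos h hR hd hc hx), inv_mul_cancel₀ hx.ne',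
    ENNReal.ofReal_one]

lemma tsum_crwStep_root : ∑' y, crwStep G o a o y = 1 := by
  simp only [crwStep_root h hR hd hc, mul_comm _ (srwStep G o _)]
  rw [tsum_srwStep_mul_ofReal (hd o) fun y => mul_nonneg (Nat.cast_nonneg _)
    (h.nonneg hR hd hc y o), avg_mul_left, h.avg_self hR hd hc,
    mul_inv_cancel₀ (by exact_mod_cast (hd o).ne'), ENNReal.ofReal_one]

/-- The conditioned walk stays among the vertices with positive potential. -/
lemma stepMeasure_crwStep {x : V} (hx : x = o ∨ 0 < a x o) :
    stepMeasure (crwStep G o a) x {z | 0 < a z o}ᶜ = 0 := by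
  have h1 : ∑' y, crwStep G o a x y = 1 := by
    rcases hx with rfl | hx
    · exact tsum_crwStep_root h hR hd hc
    · exact tsum_crwStep_of_pos h hR hd hc hx
  rw [stepMeasure, if_pos h1, Measure.sum_apply _ (MeasurableSet.of_discrete)]
  rw [ENNReal.tsum_eq_zero]
  intro y
  rw [Measure.smul_apply, smul_eq_mul, Measure.dirac_apply' _ MeasurableSet.of_discrete]
  by_cases hy : 0 < a y o
  · simp [hy]
  · have hy0 : a y o = 0 := le_antisymm (not_lt.1 hy) (h.nonneg hR hd hc y o)
    have : crwStep G o a x y = 0 := by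
      rcases hx with rfl | hx
      · rw [crwStep_root h hR hd hc, hy0]; simp
      · rw [crwStep_of_pos h hR hd hc hx, hy0]; simp
    rw [this, zero_mul]

/-- `a(·,o)` is nonnegative and harmonic off `o`, hence superharmonic for the killed walk. In
particular, a start of zero potential cannot reach a vertex of positive potential before the walk is
killed. -/
lemma killedDensity_mul_le (n : ℕ) (z b : V) :
    a b o * G.degree b * killedDensity G {o} n z b ≤ a z o := by
  classical
  induction n generalizing z with
  | zero =>
    simp only [killedDensity]
    split_ifs with hz
    · have : (G.degree b : ℝ) ≠ 0 := by exact_mod_cast (hd b).ne'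
      rw [mul_assoc, mul_inv_cancel₀ this, mul_one, hz.1]
    · rw [mul_zero]
      exact h.nonneg hR hd hc z o
  | succ n ih =>
    simp only [killedDensity]
    split_ifs with hz
    · rw [mul_zero]
      exact h.nonneg hR hd hc z o
    · rw [← avg_mul_left, ← h.avg_eq hR hd hc (x := z) (y := o) hz]
      exact avg_mono fun u _ => ih u

lemma chainLaw_crwStep_eq (n : ℕ) {y : V} (hy : 0 < a y o) (b : V) :
    chainLaw (crwStep G o a) y {ξ | ξ n = b} =
      ENNReal.ofReal (a b o * G.degree b * killedDensity G {o} n y b / a y o) := by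
  classical
  have hm : ∀ n, MeasurableSet {ξ : ℕ → V | ξ n = b} := fun n => measurableSet_path_mem n {b}
  induction n generalizing y with
  | zero =>
    have hyo := ne_root_of_pos h hR hd hc hy
    simp only [killedDensity]
    by_cases hyb : y = b
    · subst hyb
      have : (G.degree y : ℝ) ≠ 0 := by exact_mod_cast (hd y).ne'
      rw [if_pos ⟨rfl, hyo⟩, mul_assoc, mul_inv_cancel₀ this, mul_one, div_self hy.ne',
        ENNReal.ofReal_one]
      exact (mem_ae_iff_prob_eq_one (hm 0)).1 (chainLaw_start _ y)
    · rw [if_neg fun h => hyb h.1, mul_zero, zero_div, ENNReal.ofReal_zero]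
      refine measure_mono_null (t := {ξ | ¬ ξ 0 = y}) ?_ (chainLaw_start _ y)
      intro ξ hξ h'
      exact hyb ((show ξ 0 = y from h').symm.trans hξ)
  | succ n ih =>
    have hyo : y ∉ ({o} : Set V) := ne_root_of_pos h hR hd hc hy
    rw [chainLaw_apply _ _ (tsum_crwStep_of_pos h hR hd hc hy) (hm _)]
    have e : consPath y ⁻¹' {ξ | ξ (n + 1) = b} = {ξ | ξ n = b} := rfl
    simp only [killedDensity, if_neg hyo, e]
    rw [← avg_mul_left, div_eq_inv_mul, ← avg_mul_left, ← tsum_srwStep_mul_ofReal (hd y)]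
    swap
    · exact fun z => mul_nonneg (inv_nonneg.2 hy.le) (mul_nonneg (mul_nonneg
        (h.nonneg hR hd hc b o) (Nat.cast_nonneg _)) (killedDensity_nonneg _ _ _ _))
    refine tsum_congr fun z => ?_
    rw [crwStep_of_pos h hR hd hc hy, mul_right_comm, mul_comm]
    congr 1
    by_cases hz : 0 < a z o
    · rw [ih hz, ← ENNReal.ofReal_mul (div_nonneg hz.le hy.le)]
      congr 1
      field_simp
    -- The transform divides by `a z o`, so vertices of zero potential need a separate argument:
    -- both sides vanish there.
    · have hz0 : a z o = 0 := le_antisymm (not_lt.1 hz) (h.nonneg hR hd hc z o)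
      have h1 := killedDensity_mul_le h hR hd hc n z b
      rw [hz0] at h1
      have h2 : a b o * G.degree b * killedDensity G {o} n z b = 0 :=
        le_antisymm h1 (mul_nonneg (mul_nonneg
          (h.nonneg hR hd hc b o) (Nat.cast_nonneg _)) (killedDensity_nonneg _ _ _ _))
      rw [h2, hz0]
      simp

lemma visits_crwStep {y : V} (hy : 0 < a y o) (b : V) :
    visits (crwStep G o a) y b =
      ENNReal.ofReal (a b o * G.degree b * (greenFn G {o} y b / a y o)) := by
  have hs := summable_killedDensity hd hc (Set.singleton_nonempty o) y b
  have : ∀ n, a b o * G.degree b * killedDensity G {o} n y b / a y o =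
      (a b o * G.degree b / a y o) * killedDensity G {o} n y b := fun n => by ring
  simp only [visits, chainLaw_crwStep_eq h hR hd hc _ hy, this]
  rw [← ENNReal.ofReal_tsum_of_nonneg _ (hs.mul_left _), tsum_mul_left, ← greenFn]
  · congr 1
    ring
  · exact fun n => mul_nonneg (div_nonneg (mul_nonneg
      (h.nonneg hR hd hc b o) (Nat.cast_nonneg _)) hy.le) (killedDensity_nonneg _ _ _ _)

/-- This quotient is the only factor in `visits_crwStep` that depends on the start, so the Martin
kernel tends to 1. -/
lemma tendsto_greenFn_div {y : V} (hy : 0 < a y o) :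
    Tendsto (fun b => greenFn G {o} y b / a y o) cofinite (𝓝 1) := by
  have := (h.tendsto_greenFn hR hd hc y o).div_const (a y o)
  rwa [div_self hy.ne'] at this

/-- If there are infinitely many vertices `b` with `a(o, b) ≤ a(b, o)`, then the traces of two
independent conditioned walks have infinite intersection. -/
lemma crwLaw_ae_infinite_inter_range (hinf : {b | a o b ≤ a b o}.Infinite) {x y : V}
    (hx : x = o ∨ 0 < a x o) (hy : y = o ∨ 0 < a y o) :
    ∀ᵐ ξ ∂((crwLaw G o a x).prod (crwLaw G o a y)),
      (Set.range ξ.1 ∩ Set.range ξ.2).Infinite := by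
  have hpos : ∀ b, b ≠ o → a o b ≤ a b o → 0 < a b o := by
    intro b hb hab
    have h1 := h.add_swap hR hd hc hb
    have h2 := greenFn_pos hd hc (Set.singleton_nonempty o) (x := b) hb
    linarith
  -- On `S` the ratio `g_o(b,b) / a(b,o)` is at most 2. Far away `g_o(z,b) / a(z,o)` exceeds 1/2, so
  -- `δ = 1/4` works. The root is removed because its potential is 0.
  refine ae_infinite_inter_range (crwStep G o a) (K := {z | 0 < a z o})
    (S := {b | a o b ≤ a b o} \ {o}) (δ := ENNReal.ofReal (1 / 4))
    (fun z hz => stepMeasure_crwStep h hR hd hc (Or.inr hz)) ?_ ?_ ?_ ?_ (by simp) ?_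
    (stepMeasure_crwStep h hR hd hc hx) (stepMeasure_crwStep h hR hd hc hy)
  · intro z hz b
    rw [visits_crwStep h hR hd hc hz]
    exact ENNReal.ofReal_ne_top
  · intro z hz z' hz' C hC hC'
    have h1 := tendsto_greenFn_div h hR hd hc hz
    have h2 := (tendsto_greenFn_div h hR hd hc hz').const_mul C.toReal
    have h3 : (1 : ℝ) < C.toReal * 1 := by
      rw [mul_one, ← ENNReal.toReal_one]
      exact (ENNReal.toReal_lt_toReal ENNReal.one_ne_top hC').2 hC
    filter_upwards [h1.eventually_lt h2 h3] with b hb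
    rw [visits_crwStep h hR hd hc hz, visits_crwStep h hR hd hc hz', ← ENNReal.ofReal_toReal hC',
      ← ENNReal.ofReal_mul ENNReal.toReal_nonneg]
    refine ENNReal.ofReal_le_ofReal ?_
    rw [mul_left_comm]
    exact mul_le_mul_of_nonneg_left hb.le
      (mul_nonneg (h.nonneg hR hd hc b o) (Nat.cast_nonneg _))
  · exact fun b hb => hpos b hb.2 hb.1
  · exact hinf.sdiff (Set.finite_singleton o)
  · intro z hz
    filter_upwards [(tendsto_greenFn_div h hR hd hc hz).eventually_const_lt
      (show (1 / 2 : ℝ) < 1 by norm_num)] with b hb hbS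
    have hb0 := hpos b hbS.2 hbS.1
    rw [visits_crwStep h hR hd hc hz, visits_crwStep h hR hd hc hb0,
      ← ENNReal.ofReal_mul (by norm_num)]
    refine ENNReal.ofReal_le_ofReal ?_
    have h1 := h.add_swap hR hd hc hbS.2
    have h2 : a o b ≤ a b o := hbS.1
    have h3 : greenFn G {o} b b / a b o ≤ 2 := by
      rw [div_le_iff₀ hb0]
      linarith
    rw [mul_left_comm]
    refine mul_le_mul_of_nonneg_left ?_ (mul_nonneg hb0.le (Nat.cast_nonneg _))
    linarith

end Conditioned

/-! ### Isomorphisms of balls -/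

section BallTransport

variable {V V' : Type} {G : SimpleGraph V} {G' : SimpleGraph V'} {o : V} {o' : V'} {m : ℕ}
  (φ : G.induce {v | G.dist o v ≤ m} ≃g G'.induce {v | G'.dist o' v ≤ m})

/-- The bound `dist o x + k ≤ m` keeps a geodesic from `x` to `v` inside the ball, where adjacency
is transported. -/
lemma dist_map_le (hc : G.Connected) {x : V} (k : ℕ) :
    ∀ {v : V} (hx : G.dist o x ≤ m) (hv : G.dist o v ≤ m), G.dist x v = k → G.dist o x + k ≤ m →
      G'.dist (φ ⟨x, hx⟩ : V') (φ ⟨v, hv⟩ : V') ≤ k := by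
  induction k with
  | zero =>
    intro v hx hv h0 _
    obtain rfl := hc.dist_eq_zero_iff.1 h0
    simp
  | succ k ih =>
    intro v hx hv hk hm
    obtain ⟨p, hp⟩ := hc.exists_walk_length_eq_dist v x
    rw [SimpleGraph.dist_comm, hk] at hp
    cases p with
    | nil => simp at hp
    | @cons _ u _ hvu q =>
      simp only [SimpleGraph.Walk.length_cons] at hp
      have h1 : G.dist x u ≤ k := by
        rw [SimpleGraph.dist_comm]
        exact (SimpleGraph.dist_le q).trans (by omega)
      have h2 : G.dist x v ≤ G.dist x u + G.dist u v := hc.dist_triangle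
      have h3 : G.dist u v = 1 := SimpleGraph.dist_eq_one_iff_adj.2 hvu.symm
      have h4 : G.dist x u = k := by omega
      have h5 : G.dist o u ≤ G.dist o x + G.dist x u := hc.dist_triangle
      have hu : G.dist o u ≤ m := by omega
      have h6 := ih hx hu h4 (by omega)
      have hadj : (G.induce {v | G.dist o v ≤ m}).Adj ⟨u, hu⟩ ⟨v, hv⟩ := hvu.symm
      have hadj' : G'.Adj (φ ⟨u, hu⟩ : V') (φ ⟨v, hv⟩ : V') := φ.map_adj_iff.2 hadj
      have h7 := hadj'.reachable
      have h8 := SimpleGraph.dist_eq_one_iff_adj.2 hadj'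
      by_cases hr : G'.Reachable (φ ⟨x, hx⟩ : V') (φ ⟨u, hu⟩ : V')
      · obtain ⟨w, hw⟩ := hr.exists_walk_length_eq_dist
        have := SimpleGraph.dist_le (w.concat hadj')
        rw [SimpleGraph.Walk.length_concat] at this
        omega
      -- Connectedness of `G'` is not assumed here; unreachable vertices have distance 0 by
      -- convention.
      · have : ¬ G'.Reachable (φ ⟨x, hx⟩ : V') (φ ⟨v, hv⟩ : V') :=
          fun h => hr (h.trans h7.symm)
        rw [SimpleGraph.dist_eq_zero_of_not_reachable this]
        exact Nat.zero_le _

variable (hc : G.Connected) (hc' : G'.Connected)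
  (hφ : ∀ v : {v | G.dist o v ≤ m}, (v : V) = o ↔ (φ v : V') = o')
include hc hc' hφ

lemma dist_root_map {v : V} (hv : G.dist o v ≤ m) : G'.dist o' (φ ⟨v, hv⟩ : V') = G.dist o v := by
  have ho : G.dist o o ≤ m := by simp
  have ho' : G'.dist o' o' ≤ m := by simp
  have h1 : (φ ⟨o, ho⟩ : V') = o' := (hφ _).1 rfl
  have h2 : (φ.symm ⟨o', ho'⟩ : V) = o := by
    refine (hφ _).2 ?_
    rw [φ.apply_symm_apply]
  refine le_antisymm ?_ ?_
  · have := dist_map_le φ hc (G.dist o v) ho hv rfl (by simpa using hv)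
    rwa [h1] at this
  · have h3 : G'.dist o' (φ ⟨v, hv⟩ : V') ≤ m := (φ ⟨v, hv⟩).2
    have := dist_map_le φ.symm hc' (G'.dist o' (φ ⟨v, hv⟩ : V')) ho' h3 rfl (by simpa using h3)
    rw [h2] at this
    simpa using this

lemma dist_map {x v : V} (hx : G.dist o x ≤ m) (hv : G.dist o v ≤ m)
    (h : G.dist o x + G.dist x v ≤ m) :
    G'.dist (φ ⟨x, hx⟩ : V') (φ ⟨v, hv⟩ : V') = G.dist x v := by
  have h1 := dist_map_le φ hc _ hx hv rfl h
  refine le_antisymm h1 ?_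
  have h2 := dist_root_map φ hc hc' hφ hx
  have := dist_map_le φ.symm hc' (G'.dist (φ ⟨x, hx⟩ : V') (φ ⟨v, hv⟩ : V'))
    (φ ⟨x, hx⟩).2 (φ ⟨v, hv⟩).2 rfl (by omega)
  simpa using this

/-- An isomorphism of balls around the roots restricts to isomorphisms of smaller balls around
other vertices. -/
lemma exists_restrict_iso {x : V} {x' : V'} {r : ℕ} (hx : G.dist o x ≤ m)
    (h : G.dist o x + r ≤ m) (hxx' : (φ ⟨x, hx⟩ : V') = x') :
    ∃ ψ : G.induce {v | G.dist x v ≤ r} ≃g G'.induce {v | G'.dist x' v ≤ r},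
      ∀ v (hv : G.dist x v ≤ r) (hv' : G.dist o v ≤ m), (ψ ⟨v, hv⟩ : V') = φ ⟨v, hv'⟩ := by
  subst hxx'
  have hφ' : ∀ v : {v | G'.dist o' v ≤ m}, (v : V') = o' ↔ (φ.symm v : V) = o := by
    intro v
    rw [hφ, φ.apply_symm_apply]
  have hb : ∀ v, G.dist x v ≤ r → G.dist o v ≤ m := fun v hv =>
    (hc.dist_triangle (v := x)).trans (by omega)
  have hx' := dist_root_map φ hc hc' hφ hx
  have hb' : ∀ v, G'.dist (φ ⟨x, hx⟩ : V') v ≤ r → G'.dist o' v ≤ m := fun v hv =>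
    (hc'.dist_triangle (v := (φ ⟨x, hx⟩ : V'))).trans (by omega)
  refine ⟨⟨⟨fun v => ⟨φ ⟨v.1, hb v.1 v.2⟩, ?_⟩, fun v => ⟨φ.symm ⟨v.1, hb' v.1 v.2⟩, ?_⟩,
    fun v => ?_, fun v => ?_⟩, ?_⟩, fun v hv hv' => rfl⟩
  · change G'.dist _ _ ≤ r
    have h1 : G.dist x v.1 ≤ r := v.2
    rw [dist_map φ hc hc' hφ hx (hb v.1 v.2) (by omega)]
    exact h1
  · change G.dist _ _ ≤ r
    have h1 : G'.dist (φ ⟨x, hx⟩ : V') v.1 ≤ r := v.2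
    have := dist_map φ.symm hc' hc hφ' (φ ⟨x, hx⟩).2 (hb' v.1 v.2) (by omega)
    simp only [Subtype.coe_eta, RelIso.symm_apply_apply] at this
    rw [this]
    exact h1
  · simp
  · simp
  · intro u v
    exact φ.map_adj_iff (v := ⟨u.1, hb u.1 u.2⟩) (w := ⟨v.1, hb v.1 v.2⟩)

variable [G.LocallyFinite] [G'.LocallyFinite]

lemma sum_neighborFinset_map {x : V} (hx : G.dist o x ≤ m) (h : G.dist o x + 1 ≤ m)
    {f : V → ℝ} {f' : V' → ℝ}
    (hf : ∀ z (hz : G.dist o z ≤ m), G.Adj x z → f' (φ ⟨z, hz⟩ : V') = f z) :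
    ∑ z ∈ G'.neighborFinset (φ ⟨x, hx⟩ : V'), f' z = ∑ z ∈ G.neighborFinset x, f z := by
  have hb : ∀ z, G.Adj x z → G.dist o z ≤ m := fun z hz => by
    have h1 : G.dist o z ≤ G.dist o x + G.dist x z := hc.dist_triangle
    have h2 : G.dist x z = 1 := SimpleGraph.dist_eq_one_iff_adj.2 hz
    omega
  have hb' : ∀ z, G'.Adj (φ ⟨x, hx⟩ : V') z → G'.dist o' z ≤ m := fun z hz => by
    have h1 : G'.dist o' z ≤ G'.dist o' (φ ⟨x, hx⟩ : V') + G'.dist (φ ⟨x, hx⟩ : V') z :=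
      hc'.dist_triangle
    have h2 := SimpleGraph.dist_eq_one_iff_adj.2 hz
    have h3 := dist_root_map φ hc hc' hφ hx
    omega
  symm
  refine Finset.sum_bij (fun z hz => (φ ⟨z, hb z (by simpa using hz)⟩ : V')) ?_ ?_ ?_ ?_
  · intro z hz
    rw [SimpleGraph.mem_neighborFinset] at hz ⊢
    exact φ.map_adj_iff (v := ⟨x, hx⟩) (w := ⟨z, hb z hz⟩) |>.2 hz
  · intro z hz w hw hzw
    have := φ.injective (Subtype.ext hzw)
    simpa using this
  · intro z hz
    rw [SimpleGraph.mem_neighborFinset] at hz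
    have h1 : G.Adj x (φ.symm ⟨z, hb' z hz⟩ : V) := by
      refine φ.map_adj_iff (v := ⟨x, hx⟩) (w := φ.symm ⟨z, hb' z hz⟩) |>.1 ?_
      rw [φ.apply_symm_apply]
      exact hz
    exact ⟨_, by simpa using h1, by simp⟩
  · intro z hz
    exact (hf z _ (by simpa using hz)).symm

lemma degree_map {x : V} (hx : G.dist o x ≤ m) (h : G.dist o x + 1 ≤ m) :
    G'.degree (φ ⟨x, hx⟩ : V') = G.degree x := by
  have := sum_neighborFinset_map φ hc hc' hφ hx h (f := fun _ => 1) (f' := fun _ => 1)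
    fun _ _ _ => rfl
  simp only [Finset.sum_const, SimpleGraph.card_neighborFinset_eq_degree, nsmul_eq_mul,
    mul_one] at this
  exact_mod_cast this

lemma avg_map {x : V} (hx : G.dist o x ≤ m) (h : G.dist o x + 1 ≤ m) {f : V → ℝ} {f' : V' → ℝ}
    (hf : ∀ z (hz : G.dist o z ≤ m), G.Adj x z → f' (φ ⟨z, hz⟩ : V') = f z) :
    avg G' f' (φ ⟨x, hx⟩ : V') = avg G f x := by
  rw [avg, avg, sum_neighborFinset_map φ hc hc' hφ hx h hf, degree_map φ hc hc' hφ hx h]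

/-- Walk killed on the sphere of radius `r` never leaves the ball. The extra unit of radius makes
the degrees on the sphere visible. -/
lemma killedDensity_map {r : ℕ} (hr : r + 1 ≤ m) (n : ℕ) {x y : V} (hx : G.dist o x ≤ r)
    (hy : G.dist o y ≤ r) :
    killedDensity G' {v | G'.dist o' v = r} n (φ ⟨x, hx.trans (by omega)⟩ : V')
      (φ ⟨y, hy.trans (by omega)⟩ : V') = killedDensity G {v | G.dist o v = r} n x y := by
  have hdist : ∀ {v : V} (hv : G.dist o v ≤ m), G'.dist o' (φ ⟨v, hv⟩ : V') = G.dist o v :=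
    fun hv => dist_root_map φ hc hc' hφ hv
  induction n generalizing x with
  | zero =>
    simp only [killedDensity]
    rw [degree_map φ hc hc' hφ _ (by omega)]
    have h1 : ((φ ⟨x, hx.trans (by omega)⟩ : V') ∈ {v | G'.dist o' v = r}) ↔
        x ∈ {v | G.dist o v = r} := by
      change G'.dist _ _ = r ↔ G.dist _ _ = r
      rw [hdist]
    have h2 : ((φ ⟨x, hx.trans (by omega)⟩ : V') = φ ⟨y, hy.trans (by omega)⟩) ↔ x = y := by
      rw [← Subtype.ext_iff, φ.injective.eq_iff, Subtype.mk.injEq]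
    have h3 := and_congr h2 (not_congr h1)
    by_cases hxy : x = y ∧ x ∉ {v | G.dist o v = r}
    · rw [if_pos hxy, if_pos (h3.2 hxy)]
    · rw [if_neg hxy, if_neg (mt h3.1 hxy)]
  | succ n ih =>
    simp only [killedDensity]
    have h1 : ((φ ⟨x, hx.trans (by omega)⟩ : V') ∈ {v | G'.dist o' v = r}) ↔
        x ∈ {v | G.dist o v = r} := by
      change G'.dist _ _ = r ↔ G.dist _ _ = r
      rw [hdist]
    simp only [h1]
    split_ifs with hxr
    · rfl
    · have hxr : G.dist o x ≠ r := hxr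
      refine avg_map φ hc hc' hφ _ (by omega) fun z hz hxz => ?_
      refine ih ?_
      have h2 : G.dist o z ≤ G.dist o x + G.dist x z := hc.dist_triangle
      have h3 : G.dist x z = 1 := SimpleGraph.dist_eq_one_iff_adj.2 hxz
      omega

lemma greenFn_map {r : ℕ} (hr : r + 1 ≤ m) {x y : V} (hx : G.dist o x ≤ r)
    (hy : G.dist o y ≤ r) :
    greenFn G' {v | G'.dist o' v = r} (φ ⟨x, hx.trans (by omega)⟩ : V')
      (φ ⟨y, hy.trans (by omega)⟩ : V') = greenFn G {v | G.dist o v = r} x y :=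
  tsum_congr fun n => killedDensity_map φ hc hc' hφ hr n hx hy

end BallTransport

/-! ### Measurability on the space of rooted graphs -/

section Local

variable {X : Type*}

/-- The sets that are determined by a single ball. -/
def localSets (B : ℕ → X → X → Prop) : Set (Set X) :=
  {U | ∃ r, ∀ R R', B r R R' → R ∈ U → R' ∈ U}

variable {B : ℕ → X → X → Prop}

lemma isPiSystem_localSets (mono : ∀ {r s R R'}, r ≤ s → B s R R' → B r R R') :
    IsPiSystem (localSets B) := by
  rintro U ⟨r, hr⟩ U' ⟨r', hr'⟩ -
  exact ⟨max r r', fun R R' h hR => ⟨hr R R' (mono (le_max_left _ _) h) hR.1,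
    hr' R R' (mono (le_max_right _ _) h) hR.2⟩⟩

/-- The `σ`-algebra of the local topology is generated by the sets determined by a single ball. -/
lemma comap_borel_eq_generateFrom {s : Setoid X} (refl : ∀ r R, B r R R)
    (trans : ∀ {r R R' R''}, B r R R' → B r R' R'' → B r R R'')
    (mono : ∀ {r s R R'}, r ≤ s → B s R R' → B r R R')
    (of_rel : ∀ {r R R'}, s.r R R' → B r R R') :
    MeasurableSpace.comap (Quotient.mk s) (@borel (Quotient s) (TopologicalSpace.generateFrom
      {U | ∃ (r : ℕ) (R : X), U = {g | ∃ R', Quotient.mk s R' = g ∧ B r R R'}})) =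
      MeasurableSpace.generateFrom (localSets B) := by
  let _ : TopologicalSpace (Quotient s) := TopologicalSpace.generateFrom
      {U | ∃ (r : ℕ) (R : X), U = {g | ∃ R', Quotient.mk s R' = g ∧ B r R R'}}
  have hopen : ∀ O : Set (Quotient s), IsOpen O → ∀ R, Quotient.mk s R ∈ O →
      ∃ r, ∀ R', B r R R' → Quotient.mk s R' ∈ O := by
    intro O hO
    induction hO with
    | basic U hU =>
      obtain ⟨r, R₀, rfl⟩ := hU
      rintro R ⟨R₁, h1, h2⟩
      exact ⟨r, fun R' hR' => ⟨R', rfl, trans (trans h2 (of_rel (Quotient.exact h1))) hR'⟩⟩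
    | univ => exact fun _ _ => ⟨0, fun _ _ => trivial⟩
    | inter U U' _ _ ih ih' =>
      rintro R ⟨h, h'⟩
      obtain ⟨r, hr⟩ := ih R h
      obtain ⟨r', hr'⟩ := ih' R h'
      exact ⟨max r r', fun R' hR' => ⟨hr R' (mono (le_max_left _ _) hR'),
        hr' R' (mono (le_max_right _ _) hR')⟩⟩
    | sUnion 𝒰 _ ih =>
      rintro R ⟨U, hU, h⟩
      obtain ⟨r, hr⟩ := ih U hU R h
      exact ⟨r, fun R' hR' => ⟨U, hU, hr R' hR'⟩⟩
  refine le_antisymm ?_ ?_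
  · rw [borel, MeasurableSpace.comap_generateFrom]
    refine MeasurableSpace.generateFrom_le ?_
    rintro _ ⟨O, hO, rfl⟩
    -- Only countably many radii occur, and for a fixed radius any union of ball types is a local
    -- set. Hence an open set is a countable union of local sets.
    have : Quotient.mk s ⁻¹' O = ⋃ r, {R | ∀ R', B r R R' → Quotient.mk s R' ∈ O} := by
      ext R
      rw [Set.mem_iUnion]
      exact ⟨fun h => hopen O hO R h, fun ⟨r, hr⟩ => hr R (refl r R)⟩
    rw [this]
    refine MeasurableSet.iUnion fun r => MeasurableSpace.measurableSet_generateFrom ⟨r, ?_⟩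
    exact fun R R' h hR R'' h' => hR R'' (trans h h')
  · refine MeasurableSpace.generateFrom_le ?_
    rintro U ⟨r, hr⟩
    refine ⟨Quotient.mk s '' U, ?_, ?_⟩
    · refine MeasurableSpace.measurableSet_generateFrom ?_
      have : Quotient.mk s '' U = ⋃ R ∈ U, {g | ∃ R', Quotient.mk s R' = g ∧ B r R R'} := by
        ext g
        simp only [Set.mem_iUnion]
        constructor
        · rintro ⟨R, hR, rfl⟩
          exact ⟨R, hR, R, rfl, refl r R⟩
        · rintro ⟨R, hR, R', rfl, h⟩
          exact ⟨R', hr R R' h hR, rfl⟩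
      change IsOpen (Quotient.mk s '' U)
      rw [this]
      exact isOpen_biUnion fun R _ => TopologicalSpace.isOpen_generateFrom_of_mem ⟨r, R, rfl⟩
    · ext R
      constructor
      · rintro ⟨R', hR', h⟩
        exact hr R' R (of_rel (Quotient.exact h)) hR'
      · exact fun h => ⟨R, h, rfl⟩

/-- Functions that are locally determined by balls are measurable. -/
lemma measurable_of_local {Y : Type*} [MeasurableSpace Y] (refl : ∀ r R, B r R R)
    (trans : ∀ {r R R' R''}, B r R R' → B r R' R'' → B r R R'')
    {f : X → Y} (hf : ∀ R, ∃ r, ∀ R', B r R R' → f R' = f R) :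
    @Measurable _ _ (MeasurableSpace.generateFrom (localSets B)) _ f := by
  intro s _
  have : f ⁻¹' s = ⋃ r, {R | ∀ R', B r R R' → f R' ∈ s} := by
    ext R
    rw [Set.mem_iUnion]
    constructor
    · intro h
      obtain ⟨r, hr⟩ := hf R
      refine ⟨r, fun R' hR' => ?_⟩
      rw [hr R' hR']
      exact h
    · exact fun ⟨r, hr⟩ => hr R (refl r R)
  rw [this]
  refine @MeasurableSet.iUnion _ _ (MeasurableSpace.generateFrom (localSets B)) _ _ fun r =>
    MeasurableSpace.measurableSet_generateFrom ⟨r, ?_⟩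
  exact fun R R' h hR R'' h' => hR R'' (trans h h')

end Local

instance (R : RootedGraph) : R.G.LocallyFinite := fun v => (R.locallyFinite v).fintype

/-! ### Ball equivalence of rooted and doubly rooted graphs -/

section BallIso

lemma RootedGraph.dist_root_le (R : RootedGraph) (r : ℕ) : R.G.dist R.o R.o ≤ r := by simp

/-- Restriction of an isomorphism of balls around the roots to smaller balls around the roots. -/
lemma exists_restrict_ballIso {R R' : RootedGraph} {r s : ℕ} (hrs : r ≤ s)
    (φ : R.G.induce (R.ball s) ≃g R'.G.induce (R'.ball s))
    (hφ : ∀ v : R.ball s, (v : R.V) = R.o ↔ (φ v : R'.V) = R'.o) :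
    ∃ ψ : R.G.induce (R.ball r) ≃g R'.G.induce (R'.ball r),
      (∀ v (hv : v ∈ R.ball r) (hv' : v ∈ R.ball s), (ψ ⟨v, hv⟩ : R'.V) = φ ⟨v, hv'⟩) ∧
      ∀ v : R.ball r, (v : R.V) = R.o ↔ (ψ v : R'.V) = R'.o := by
  have h1 : (φ ⟨R.o, R.dist_root_le s⟩ : R'.V) = R'.o := (hφ _).1 rfl
  obtain ⟨ψ, hψ⟩ : ∃ ψ : R.G.induce (R.ball r) ≃g R'.G.induce (R'.ball r),
      ∀ v (hv : v ∈ R.ball r) (hv' : v ∈ R.ball s), (ψ ⟨v, hv⟩ : R'.V) = φ ⟨v, hv'⟩ :=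
    exists_restrict_iso (r := r) φ R.connected R'.connected hφ (R.dist_root_le s)
      (by simpa using hrs) h1
  refine ⟨ψ, hψ, fun v => ?_⟩
  have hv : (v : R.V) ∈ R.ball s := le_trans (show R.G.dist R.o v ≤ r from v.2) hrs
  have e : (ψ v : R'.V) = φ ⟨v, hv⟩ := hψ v.1 v.2 hv
  exact (hφ ⟨v, hv⟩).trans ⟨fun k => e.trans k, fun k => e.symm.trans k⟩

namespace BirootedGraph.BallIso

lemma refl (r : ℕ) (R : BirootedGraph) : BallIso r R R :=
  ⟨SimpleGraph.Iso.refl, fun _ => Iff.rfl, fun _ => Iff.rfl⟩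

lemma symm {r : ℕ} {R R' : BirootedGraph} : BallIso r R R' → BallIso r R' R := by
  rintro ⟨φ, h1, h2⟩
  refine ⟨φ.symm, fun v => ?_, fun v => ?_⟩
  · rw [h1, φ.apply_symm_apply]
  · rw [h2, φ.apply_symm_apply]

lemma trans {r : ℕ} {R R' R'' : BirootedGraph} :
    BallIso r R R' → BallIso r R' R'' → BallIso r R R'' := by
  rintro ⟨φ, h1, h2⟩ ⟨ψ, k1, k2⟩
  exact ⟨φ.trans ψ, fun v => (h1 v).trans (k1 (φ v)), fun v => (h2 v).trans (k2 (φ v))⟩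

lemma mono {r s : ℕ} {R R' : BirootedGraph} (hrs : r ≤ s) : BallIso s R R' → BallIso r R R' := by
  rintro ⟨φ, h1, h2⟩
  obtain ⟨ψ, hψ, hψo⟩ := exists_restrict_ballIso hrs φ h1
  refine ⟨ψ, hψo, fun v => ?_⟩
  have hv : (v : R.V) ∈ R.toRootedGraph.ball s :=
    le_trans (show R.G.dist R.o v ≤ r from v.2) hrs
  rw [show (ψ v : R'.V) = φ ⟨v, hv⟩ from hψ v.1 v.2 hv]
  exact h2 ⟨v, hv⟩

lemma of_rel {r : ℕ} {R R' : BirootedGraph} (h : BirootedGraph.setoid.r R R') :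
    BallIso r R R' := by
  obtain ⟨φ, ho, hρ⟩ := h
  have hdist : ∀ u v, R'.G.dist (φ u) (φ v) = R.G.dist u v := by
    intro u v
    refine le_antisymm ?_ ?_
    · obtain ⟨p, hp⟩ := R.connected.exists_walk_length_eq_dist u v
      have := SimpleGraph.dist_le (p.map φ.toHom)
      rw [SimpleGraph.Walk.length_map, hp] at this
      exact this
    · obtain ⟨p, hp⟩ := R'.connected.exists_walk_length_eq_dist (φ u) (φ v)
      have := SimpleGraph.dist_le (p.map φ.symm.toHom)
      rw [SimpleGraph.Walk.length_map, hp] at this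
      have e : ∀ w, φ.symm.toHom (φ w) = w := fun w => φ.symm_apply_apply w
      rwa [e, e] at this
  have hball : ∀ v, v ∈ R.toRootedGraph.ball r ↔ φ v ∈ R'.toRootedGraph.ball r := by
    intro v
    change R.G.dist R.o v ≤ r ↔ R'.G.dist R'.o (φ v) ≤ r
    rw [← ho, hdist]
  refine ⟨⟨φ.toEquiv.subtypeEquiv hball, fun {a b} => φ.map_adj_iff (v := a.1) (w := b.1)⟩,
    fun v => ?_, fun v => ?_⟩
  · change (v : R.V) = R.o ↔ φ v = R'.o
    rw [← ho, φ.injective.eq_iff]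
  · change (v : R.V) = R.ρ ↔ φ v = R'.ρ
    rw [← hρ, φ.injective.eq_iff]

lemma toRootedGraph {r : ℕ} {R R' : BirootedGraph} (h : BallIso r R R') :
    R.toRootedGraph.BallIso r R'.toRootedGraph := by
  obtain ⟨φ, h1, -⟩ := h
  exact ⟨φ, h1⟩

end BirootedGraph.BallIso

namespace RootedGraph.BallIso

lemma refl (r : ℕ) (R : RootedGraph) : BallIso r R R :=
  ⟨SimpleGraph.Iso.refl, fun _ => Iff.rfl⟩

lemma symm {r : ℕ} {R R' : RootedGraph} : BallIso r R R' → BallIso r R' R := by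
  rintro ⟨φ, h1⟩
  refine ⟨φ.symm, fun v => ?_⟩
  rw [h1, φ.apply_symm_apply]

lemma trans {r : ℕ} {R R' R'' : RootedGraph} :
    BallIso r R R' → BallIso r R' R'' → BallIso r R R'' := by
  rintro ⟨φ, h1⟩ ⟨ψ, k1⟩
  exact ⟨φ.trans ψ, fun v => (h1 v).trans (k1 (φ v))⟩

lemma mono {r s : ℕ} {R R' : RootedGraph} (hrs : r ≤ s) : BallIso s R R' → BallIso r R R' := by
  rintro ⟨φ, h1⟩
  obtain ⟨ψ, hψ, hψo⟩ := exists_restrict_ballIso hrs φ h1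
  exact ⟨ψ, hψo⟩

lemma of_rel {r : ℕ} {R R' : RootedGraph} (h : RootedGraph.setoid.r R R') :
    BallIso r R R' := by
  obtain ⟨φ, ho⟩ := h
  exact (BirootedGraph.BallIso.of_rel (R := R.withSecond R.o) (R' := R'.withSecond R'.o)
    ⟨φ, ho, ho⟩).toRootedGraph

end RootedGraph.BallIso

end BallIso

/-- Working with representatives keeps the vertices available. By `comap_rootedClass`, measurability
here is measurability of the isomorphism class. -/
instance rootedGraphMeasurableSpace : MeasurableSpace RootedGraph :=
  MeasurableSpace.generateFrom (localSets RootedGraph.BallIso)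

instance birootedGraphMeasurableSpace : MeasurableSpace BirootedGraph :=
  MeasurableSpace.generateFrom (localSets BirootedGraph.BallIso)

lemma comap_rootedClass :
    MeasurableSpace.comap (Quotient.mk RootedGraph.setoid) (borel RootedClass) =
      rootedGraphMeasurableSpace :=
  comap_borel_eq_generateFrom RootedGraph.BallIso.refl
    RootedGraph.BallIso.trans RootedGraph.BallIso.mono RootedGraph.BallIso.of_rel

lemma comap_birootedClass :
    MeasurableSpace.comap (Quotient.mk BirootedGraph.setoid) (borel BirootedClass) =
      birootedGraphMeasurableSpace :=
  comap_borel_eq_generateFrom BirootedGraph.BallIso.refl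
    BirootedGraph.BallIso.trans BirootedGraph.BallIso.mono BirootedGraph.BallIso.of_rel

lemma RootedGraph.measurable_of_ballIso {Y : Type*} [MeasurableSpace Y] {f : RootedGraph → Y}
    (hf : ∀ R, ∃ r, ∀ R', RootedGraph.BallIso r R R' → f R' = f R) : Measurable f :=
  measurable_of_local RootedGraph.BallIso.refl RootedGraph.BallIso.trans hf

lemma BirootedGraph.measurable_of_ballIso {Y : Type*} [MeasurableSpace Y] {f : BirootedGraph → Y}
    (hf : ∀ R, ∃ r, ∀ R', BirootedGraph.BallIso r R R' → f R' = f R) : Measurable f :=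
  measurable_of_local BirootedGraph.BallIso.refl BirootedGraph.BallIso.trans hf

/-! ### Measurability of re-rooting and of sums over the second root -/

/-- The rooted graph `(G, ρ)`. -/
def BirootedGraph.second (R : BirootedGraph) : RootedGraph := { R.toRootedGraph with o := R.ρ }

lemma BirootedGraph.BallIso.second {r m : ℕ} {R R' : BirootedGraph}
    (h : BirootedGraph.BallIso m R R') (hm : R.G.dist R.o R.ρ + r ≤ m) :
    R.second.BallIso r R'.second := by
  obtain ⟨φ, h1, h2⟩ := h
  have hρ : R.G.dist R.o R.ρ ≤ m := by omega
  have hρ' : (φ ⟨R.ρ, hρ⟩ : R'.V) = R'.ρ := (h2 _).1 rfl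
  have h3 := exists_restrict_iso (r := r) φ R.connected R'.connected h1 hρ hm hρ'
  obtain ⟨ψ, hψ⟩ := h3
  refine ⟨ψ, fun v => ?_⟩
  have hv1 : R.G.dist R.ρ v.1 ≤ r := v.2
  have hv : R.G.dist R.o v.1 ≤ m :=
    (R.connected.dist_triangle (v := R.ρ)).trans (by omega)
  have e := hψ v.1 v.2 hv
  exact (h2 ⟨v.1, hv⟩).trans ⟨fun k => e.trans k, fun k => e.symm.trans k⟩

/-- The radius needed to see a ball around `ρ` depends on its distance from `o`; this is allowed
because the radius may vary with the graph. -/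
lemma BirootedGraph.measurable_second : Measurable BirootedGraph.second := by
  refine measurable_generateFrom ?_
  rintro U ⟨r, hr⟩
  have h : Measurable fun R : BirootedGraph => R.second ∈ U := by
    refine BirootedGraph.measurable_of_ballIso fun R => ⟨R.G.dist R.o R.ρ + r, fun R' h => ?_⟩
    have := h.second le_rfl
    exact propext ⟨fun h' => hr _ _ this.symm h', fun h' => hr _ _ this h'⟩
  exact measurableSet_setOfPred.2 h

lemma BirootedGraph.measurable_toRootedGraph : Measurable BirootedGraph.toRootedGraph := by
  refine measurable_generateFrom ?_
  rintro U ⟨r, hr⟩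
  exact MeasurableSpace.measurableSet_generateFrom
    ⟨r, fun R R' h hR => hr _ _ h.toRootedGraph hR⟩

/-- Counting measure on the doubly rooted graphs `(G, o, x)`, where `x` has distance `s` to `o`. -/
def sphereMeasure (s : ℕ) (R : RootedGraph) : Measure BirootedGraph :=
  Measure.sum fun x : {x // R.G.dist R.o x = s} => Measure.dirac (R.withSecond x)

lemma sphereMeasure_apply (s : ℕ) (R : RootedGraph) {U : Set BirootedGraph}
    (hU : MeasurableSet U) :
    sphereMeasure s R U =
      ∑' x : {x // R.G.dist R.o x = s}, U.indicator 1 (R.withSecond x) := by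
  rw [sphereMeasure, Measure.sum_apply _ hU]
  simp only [Measure.dirac_apply' _ hU]

lemma finite_sphere (R : RootedGraph) (s : ℕ) : Finite {x // R.G.dist R.o x = s} :=
  ((finite_ball R.connected R.o s).subset fun _ hv => le_of_eq hv).to_subtype

instance (s : ℕ) (R : RootedGraph) : IsFiniteMeasure (sphereMeasure s R) := by
  constructor
  have := finite_sphere R s
  have := Fintype.ofFinite {x // R.G.dist R.o x = s}
  rw [sphereMeasure_apply s R MeasurableSet.univ, tsum_fintype]
  simp

/-- An isomorphism of balls of radius `max r s` matches the spheres of radius `s`, and matched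
second roots give doubly rooted graphs with the same `r`-ball. -/
lemma sphereMeasure_apply_eq {r s : ℕ} {R R' : RootedGraph} {U : Set BirootedGraph}
    (hU : ∀ R R', BirootedGraph.BallIso r R R' → R ∈ U → R' ∈ U)
    (h : R.BallIso (max r s) R') : sphereMeasure s R' U = sphereMeasure s R U := by
  have hUm : MeasurableSet U := MeasurableSpace.measurableSet_generateFrom ⟨r, hU⟩
  obtain ⟨φ, hφ⟩ := h
  have hφs : ∀ v : R'.ball (max r s), (v : R'.V) = R'.o ↔ (φ.symm v : R.V) = R.o := by
    intro v
    rw [hφ, φ.apply_symm_apply]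
  have hd : ∀ v (hv : v ∈ R.ball (max r s)), R'.G.dist R'.o (φ ⟨v, hv⟩) = R.G.dist R.o v :=
    fun v hv => dist_root_map φ R.connected R'.connected hφ hv
  have hds : ∀ v (hv : v ∈ R'.ball (max r s)), R.G.dist R.o (φ.symm ⟨v, hv⟩) = R'.G.dist R'.o v :=
    fun v hv => dist_root_map φ.symm R'.connected R.connected hφs hv
  have hb : ∀ v, R.G.dist R.o v = s → v ∈ R.ball (max r s) := fun v hv =>
    (le_of_eq hv).trans (le_max_right r s)
  have hb' : ∀ v, R'.G.dist R'.o v = s → v ∈ R'.ball (max r s) := fun v hv =>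
    (le_of_eq hv).trans (le_max_right r s)
  rw [sphereMeasure_apply s R hUm, sphereMeasure_apply s R' hUm]
  let e : {x // R.G.dist R.o x = s} ≃ {x // R'.G.dist R'.o x = s} :=
    { toFun := fun x => ⟨φ ⟨x.1, hb x.1 x.2⟩, (hd _ _).trans x.2⟩
      invFun := fun x => ⟨φ.symm ⟨x.1, hb' x.1 x.2⟩, (hds _ _).trans x.2⟩
      left_inv := fun x => by simp
      right_inv := fun x => by simp }
  rw [← e.tsum_eq]
  refine tsum_congr fun x => ?_
  have h1 : BirootedGraph.BallIso r (R.withSecond x) (R'.withSecond (e x)) := by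
    refine BirootedGraph.BallIso.mono (le_max_left r s) ⟨φ, hφ, fun v => ?_⟩
    exact ⟨fun k => congrArg (fun w => (φ w).1) (Subtype.ext k),
      fun k => congrArg Subtype.val (φ.injective (Subtype.ext k))⟩
  have h2 : R'.withSecond (e x) ∈ U ↔ R.withSecond x ∈ U :=
    ⟨fun h => hU _ _ h1.symm h, fun h => hU _ _ h1 h⟩
  by_cases hx : R.withSecond x ∈ U
  · rw [Set.indicator_of_mem hx, Set.indicator_of_mem (h2.2 hx)]; rfl
  · rw [Set.indicator_of_notMem hx, Set.indicator_of_notMem (mt h2.1 hx)]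

lemma measurable_sphereMeasure (s : ℕ) : Measurable (sphereMeasure s) := by
  have hl : ∀ U ∈ localSets BirootedGraph.BallIso, Measurable fun R => sphereMeasure s R U := by
    rintro U ⟨r, hr⟩
    exact RootedGraph.measurable_of_ballIso fun R =>
      ⟨max r s, fun R' h => sphereMeasure_apply_eq hr h⟩
  refine Measurable.measure_of_isPiSystem (S := localSets BirootedGraph.BallIso) rfl
    (isPiSystem_localSets BirootedGraph.BallIso.mono) hl ?_
  exact hl Set.univ ⟨0, fun _ _ _ _ => trivial⟩

/-- Sums over the second root of measurable functions are measurable. -/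
lemma measurable_tsum_withSecond {F : BirootedGraph → ℝ≥0∞} (hF : Measurable F) :
    Measurable fun R : RootedGraph => ∑' x, F (R.withSecond x) := by
  -- Vertices of different graphs cannot be indexed jointly; grouping them by distance turns the sum
  -- into integrals against finite measurable kernels.
  have h1 : ∀ R : RootedGraph, ∑' x, F (R.withSecond x) =
      ∑' s, ∫⁻ b, F b ∂(sphereMeasure s R) := by
    intro R
    rw [← (Equiv.sigmaFiberEquiv (R.G.dist R.o)).tsum_eq, ENNReal.tsum_sigma']
    refine tsum_congr fun s => ?_
    rw [sphereMeasure, lintegral_sum_measure]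
    refine tsum_congr fun x => ?_
    rw [lintegral_dirac' _ hF]
    rfl
  simp only [h1]
  exact Measurable.tsum fun s =>
    (Measure.measurable_lintegral hF).comp (measurable_sphereMeasure s)

/-! ### Null recurrence -/

section NullRecurrence

variable {V : Type} {G : SimpleGraph V} [G.LocallyFinite]

/-- The degree is a reversible measure, so averaging does not increase total mass. Mass is expressed
by bounds on finite sums, which avoids summability. -/
lemma sum_degree_mul_avg_le {f : V → ℝ} (hf : ∀ x, 0 ≤ f x) {Q : ℝ}
    (hQ : ∀ K : Finset V, ∑ x ∈ K, G.degree x * f x ≤ Q) (hd : ∀ x, 0 < G.degree x)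
    (K : Finset V) : ∑ x ∈ K, G.degree x * avg G f x ≤ Q := by
  classical
  set K' := K.biUnion fun x => G.neighborFinset x with hK'
  calc ∑ x ∈ K, G.degree x * avg G f x = ∑ x ∈ K, ∑ z ∈ G.neighborFinset x, f z := by
        refine Finset.sum_congr rfl fun x _ => ?_
        have : (G.degree x : ℝ) ≠ 0 := by exact_mod_cast (hd x).ne'
        rw [avg, mul_div_cancel₀ _ this]
    _ = ∑ x ∈ K, ∑ z ∈ K', if G.Adj x z then f z else 0 := by
        refine Finset.sum_congr rfl fun x hx => ?_
        rw [← Finset.sum_filter]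
        refine Finset.sum_congr ?_ fun _ _ => rfl
        ext z
        simp only [hK', SimpleGraph.mem_neighborFinset, Finset.mem_filter, Finset.mem_biUnion]
        exact ⟨fun h => ⟨⟨x, hx, h⟩, h⟩, fun h => h.2⟩
    _ = ∑ z ∈ K', ∑ x ∈ K, if G.Adj x z then f z else 0 := Finset.sum_comm
    _ ≤ ∑ z ∈ K', G.degree z * f z := by
        refine Finset.sum_le_sum fun z _ => ?_
        rw [← Finset.sum_filter, Finset.sum_const, nsmul_eq_mul]
        refine mul_le_mul_of_nonneg_right ?_ (hf z)
        rw [← SimpleGraph.card_neighborFinset_eq_degree]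
        norm_cast
        refine Finset.card_le_card fun x hx => ?_
        simpa using (Finset.mem_filter.1 hx).2.symm
    _ ≤ Q := hQ K'

lemma avg_iterate_nonneg {f : V → ℝ} (hf : ∀ x, 0 ≤ f x) (n : ℕ) (x : V) :
    0 ≤ (avg G)^[n] f x := by
  induction n generalizing x with
  | zero => exact hf x
  | succ n ih =>
    rw [Function.iterate_succ_apply']
    exact avg_nonneg ih x

lemma avg_iterate_le {f : V → ℝ} {c : ℝ} (hf : ∀ x, f x ≤ c) (hd : ∀ x, 0 < G.degree x) (n : ℕ)
    (x : V) : (avg G)^[n] f x ≤ c := by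
  induction n generalizing x with
  | zero => exact hf x
  | succ n ih =>
    rw [Function.iterate_succ_apply']
    exact (avg_mono fun z _ => ih z).trans (avg_const (hd x) c).le

lemma sum_degree_mul_avg_iterate_le {f : V → ℝ} (hf : ∀ x, 0 ≤ f x) {Q : ℝ}
    (hQ : ∀ K : Finset V, ∑ x ∈ K, G.degree x * f x ≤ Q) (hd : ∀ x, 0 < G.degree x) (n : ℕ)
    (K : Finset V) : ∑ x ∈ K, G.degree x * (avg G)^[n] f x ≤ Q := by
  induction n generalizing K with
  | zero => exact hQ K
  | succ n ih =>
    rw [Function.iterate_succ_apply']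
    exact sum_degree_mul_avg_le (avg_iterate_nonneg hf n) ih hd K

variable (G) in
/-- Time averages of the expectations of `f` under simple random walk. -/
def timeAvg (f : V → ℝ) (N : ℕ) (x : V) : ℝ := (∑ n ∈ Finset.range N, (avg G)^[n] f x) / N

lemma timeAvg_nonneg {f : V → ℝ} (hf : ∀ x, 0 ≤ f x) (N : ℕ) (x : V) : 0 ≤ timeAvg G f N x :=
  div_nonneg (Finset.sum_nonneg fun n _ => avg_iterate_nonneg hf n x) (Nat.cast_nonneg _)

lemma timeAvg_le_one {f : V → ℝ} (hf : ∀ x, f x ≤ 1) (hd : ∀ x, 0 < G.degree x) (N : ℕ)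
    (x : V) : timeAvg G f N x ≤ 1 := by
  refine div_le_one_of_le₀ ?_ (Nat.cast_nonneg _)
  refine (Finset.sum_le_card_nsmul _ _ 1 fun n _ => avg_iterate_le hf hd n x).trans ?_
  simp

/-- On an infinite recurrent graph, the fraction of time spent in a finite set tends to zero. -/
lemma tendsto_timeAvg_indicator [Infinite V] (hG : HitsAll G) (hd : ∀ x, 0 < G.degree x)
    {F : Set V} (hF : F.Finite) (x : V) :
    Tendsto (fun N => timeAvg G (F.indicator 1) N x) atTop (𝓝 0) := by
  classical
  set f : V → ℝ := F.indicator 1 with hf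
  have hf0 : ∀ x, 0 ≤ f x := fun x => Set.indicator_nonneg (fun _ _ => zero_le_one) x
  have hf1 : ∀ x, f x ≤ 1 := fun x => Set.indicator_le_self' (fun _ _ => zero_le_one) x
  set Q : ℝ := ∑ x ∈ hF.toFinset, (G.degree x : ℝ) with hQ
  have hQ0 : 0 ≤ Q := Finset.sum_nonneg fun _ _ => Nat.cast_nonneg _
  have hmass : ∀ K : Finset V, ∑ x ∈ K, G.degree x * f x ≤ Q := by
    intro K
    have h1 : ∀ x, (G.degree x : ℝ) * f x = if x ∈ hF.toFinset then (G.degree x : ℝ) else 0 := by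
      intro x
      simp [hf, Set.indicator_apply]
    simp only [h1]
    rw [← Finset.sum_filter]
    refine Finset.sum_le_sum_of_subset_of_nonneg ?_ fun _ _ _ => Nat.cast_nonneg _
    exact fun x hx => (Finset.mem_filter.1 hx).2
  -- Along an ultrafilter all bounded time averages converge, and it is enough to show that every
  -- such limit is 0.
  rw [tendsto_iff_ultrafilter]
  intro g hg
  have hlim : ∀ x, ∃ v ∈ Set.Icc (0 : ℝ) 1, Tendsto (fun N => timeAvg G f N x) g (𝓝 v) := by
    intro x
    refine isCompact_Icc.ultrafilter_le_nhds (g.map fun N => timeAvg G f N x) ?_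
    rw [le_principal_iff]
    change (fun N => timeAvg G f N x) ⁻¹' Set.Icc (0 : ℝ) 1 ∈ (g : Filter ℕ)
    exact Filter.univ_mem' fun N => ⟨timeAvg_nonneg hf0 N x, timeAvg_le_one hf1 hd N x⟩
  choose v hv hvlim using hlim
  have hharm : ∀ x, avg G v x = v x := by
    intro x
    have h1 : Tendsto (fun N => avg G (timeAvg G f N) x - timeAvg G f N x) g
        (𝓝 (avg G v x - v x)) := (tendsto_avg hvlim x).sub (hvlim x)
    -- Telescoping: one more step of the walk changes a time average only by its two end terms
    -- divided by `N`.
    have h2 : ∀ N, avg G (timeAvg G f N) x - timeAvg G f N x =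
        ((avg G)^[N] f x - f x) / N := by
      intro N
      have e1 : avg G (timeAvg G f N) x =
          (∑ n ∈ Finset.range N, (avg G)^[n + 1] f x) / N := by
        have : timeAvg G f N = fun z => (N : ℝ)⁻¹ * ∑ n ∈ Finset.range N, (avg G)^[n] f z := by
          funext z
          rw [timeAvg, div_eq_inv_mul]
        rw [this, avg_mul_left, avg_finset_sum, div_eq_inv_mul]
        simp only [Function.iterate_succ_apply']
      rw [e1, timeAvg, ← sub_div, ← Finset.sum_sub_distrib,
        Finset.sum_range_sub (fun n => (avg G)^[n] f x)]
      rfl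
    have h3 : Tendsto (fun N : ℕ => ((avg G)^[N] f x - f x) / N) atTop (𝓝 0) := by
      refine squeeze_zero_norm (a := fun N : ℕ => 1 / (N : ℝ)) (fun N => ?_)
        tendsto_one_div_atTop_nhds_zero_nat
      rw [norm_div, Real.norm_natCast, Real.norm_eq_abs]
      gcongr
      rw [abs_le]
      have := avg_iterate_nonneg (G := G) hf0 N x
      have := avg_iterate_le hf1 hd N x
      have := hf0 x
      have := hf1 x
      constructor <;> linarith
    simp only [h2] at h1
    exact sub_eq_zero.1 (tendsto_nhds_unique h1 (h3.mono_left hg))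
  have hconst : ∀ z, v z = v x := fun z =>
    hG.eq_of_harmonic hd (S := {x}) (b := x) rfl (C := 1)
      (fun y => by rw [abs_of_nonneg (hv y).1]; exact (hv y).2) (by simp)
      (fun y _ => hharm y) z
  -- The limit is constant, while its mass is at most the total degree `Q` of `F`. As all degrees
  -- are at least 1 and `K` can be arbitrarily large, the constant must be 0.
  have hbound : ∀ K : Finset V, (K.card : ℝ) * v x ≤ Q := by
    intro K
    have h1 : ∀ N, ∑ z ∈ K, G.degree z * timeAvg G f N z ≤ Q := by
      intro N
      have h2 : ∑ z ∈ K, G.degree z * timeAvg G f N z =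
          (∑ n ∈ Finset.range N, ∑ z ∈ K, G.degree z * (avg G)^[n] f z) / N := by
        rw [Finset.sum_comm, Finset.sum_div]
        refine Finset.sum_congr rfl fun z _ => ?_
        rw [timeAvg, ← Finset.mul_sum, mul_div_assoc]
      rw [h2]
      refine div_le_of_le_mul₀ (Nat.cast_nonneg _) hQ0 ?_
      refine (Finset.sum_le_card_nsmul _ _ Q fun n _ =>
        sum_degree_mul_avg_iterate_le hf0 hmass hd n K).trans ?_
      rw [Finset.card_range, nsmul_eq_mul, mul_comm]
    have h3 : ∑ z ∈ K, G.degree z * v z ≤ Q :=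
      le_of_tendsto' (tendsto_finsetSum _ fun z _ => (hvlim z).const_mul _) h1
    refine le_trans ?_ h3
    rw [← nsmul_eq_mul]
    refine Finset.card_nsmul_le_sum _ _ _ fun z _ => ?_
    rw [hconst z]
    exact le_mul_of_one_le_left (hv x).1 (by exact_mod_cast hd z)
  have hzero : v x = 0 := by
    by_contra hne
    have hpos : 0 < v x := lt_of_le_of_ne (hv x).1 (Ne.symm hne)
    obtain ⟨n, hn⟩ := exists_nat_gt (Q / v x)
    obtain ⟨K, hK⟩ := Infinite.exists_subset_card_eq V n
    have := hbound K
    rw [hK] at this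
    rw [div_lt_iff₀ hpos] at hn
    linarith
  rw [← hzero]
  exact hvlim x

end NullRecurrence

/-! ### Stationarity under simple random walk -/

/-- The rooted graph `(G, x)`. -/
def RootedGraph.reroot (R : RootedGraph) (x : R.V) : RootedGraph := (R.withSecond x).second

lemma BirootedGraph.measurable_srwStep :
    Measurable fun R : BirootedGraph => srwStep R.G R.o R.ρ := by
  refine BirootedGraph.measurable_of_ballIso fun R => ⟨R.G.dist R.o R.ρ + 1, ?_⟩
  rintro R' ⟨φ, h1, h2⟩
  have ho : R.G.dist R.o R.o ≤ R.G.dist R.o R.ρ + 1 := by simp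
  have hρ : R.G.dist R.o R.ρ ≤ R.G.dist R.o R.ρ + 1 := by omega
  have ho' : (φ ⟨R.o, ho⟩ : R'.V) = R'.o := (h1 _).1 rfl
  have hρ' : (φ ⟨R.ρ, hρ⟩ : R'.V) = R'.ρ := (h2 _).1 rfl
  have hdeg : R'.G.degree R'.o = R.G.degree R.o :=
    (congrArg (fun v => R'.G.degree v) ho').symm.trans
      (degree_map φ R.connected R'.connected h1 ho (by simp))
  have hadj : R'.G.Adj R'.o R'.ρ ↔ R.G.Adj R.o R.ρ := by
    rw [← ho', ← hρ']
    exact φ.map_adj_iff (v := ⟨R.o, ho⟩) (w := ⟨R.ρ, hρ⟩)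
  simp only [srwStep, deg_eq_degree]
  rw [hdeg]
  by_cases h : R.G.Adj R.o R.ρ
  · rw [if_pos h, if_pos (hadj.2 h)]
  · rw [if_neg h, if_neg (mt hadj.1 h)]

/-- The law of `(G, X₁)`. -/
def rerootMeasure (R : RootedGraph) : Measure RootedGraph :=
  Measure.sum fun x => srwStep R.G R.o x • Measure.dirac (R.reroot x)

lemma lintegral_rerootMeasure (R : RootedGraph) {f : RootedGraph → ℝ≥0∞} (hf : Measurable f) :
    ∫⁻ R', f R' ∂(rerootMeasure R) = ∑' x, srwStep R.G R.o x * f (R.reroot x) := by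
  rw [rerootMeasure, lintegral_sum_measure]
  refine tsum_congr fun x => ?_
  rw [lintegral_smul_measure, lintegral_dirac' _ hf, smul_eq_mul]

lemma measurable_lintegral_rerootMeasure {f : RootedGraph → ℝ≥0∞} (hf : Measurable f) :
    Measurable fun R => ∫⁻ R', f R' ∂(rerootMeasure R) := by
  simp only [lintegral_rerootMeasure _ hf]
  exact measurable_tsum_withSecond
    (BirootedGraph.measurable_srwStep.mul (hf.comp BirootedGraph.measurable_second))

lemma measurable_rerootMeasure : Measurable rerootMeasure := by
  refine Measure.measurable_of_measurable_coe _ fun s hs => ?_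
  have := measurable_lintegral_rerootMeasure (measurable_one.indicator hs)
  simpa only [lintegral_indicator_one hs] using this

lemma degree_pos {V : Type} {G : SimpleGraph V} [G.LocallyFinite] [Infinite V]
    (hc : G.Connected) (x : V) : 0 < G.degree x := hc.preconnected.degree_pos_of_nontrivial x

section Stationary

variable {Ω : Type*} [MeasurableSpace Ω] {P : Measure Ω} {R : Ω → RootedGraph}

lemma IsReversible.measurable (hR : IsReversible P R) : Measurable R := by
  have h : Measurable[_, MeasurableSpace.comap (Quotient.mk RootedGraph.setoid)
      (borel RootedClass)] R := measurable_comap_iff.2 hR.1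
  rwa [comap_rootedClass] at h

/-- A reversible random graph is stationary under simple random walk. -/
lemma IsReversible.bind_rerootMeasure (hR : IsReversible P R)
    (hinf : ∀ᵐ ω ∂P, Infinite (R ω).V) : (P.map R).bind rerootMeasure = P.map R := by
  classical
  ext T hT
  rw [Measure.bind_apply hT measurable_rerootMeasure.aemeasurable,
    lintegral_map (by exact (Measure.measurable_coe hT).comp measurable_rerootMeasure)
      hR.measurable, Measure.map_apply hR.measurable hT]
  -- Reversibility is tested on events that look at the first root only, so one side sees `(G, o)`
  -- and the other `(G, X₁)`.
  have hU : MeasurableSet (BirootedGraph.toRootedGraph ⁻¹' T) :=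
    BirootedGraph.measurable_toRootedGraph hT
  obtain ⟨S, hS, hSU⟩ : MeasurableSet[MeasurableSpace.comap (Quotient.mk BirootedGraph.setoid)
      (borel BirootedClass)] (BirootedGraph.toRootedGraph ⁻¹' T) := by
    rwa [comap_birootedClass]
  have hmem : ∀ b : BirootedGraph, (⟦b⟧ : BirootedClass) ∈ S ↔ b.toRootedGraph ∈ T := by
    intro b
    change b ∈ Quotient.mk _ ⁻¹' S ↔ _
    rw [hSU]
    rfl
  have h := hR.2 S hS
  have e1 : ∀ᵐ ω ∂P, (∑' x, if (⟦(R ω).withSecond x⟧ : BirootedClass) ∈ S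
      then srwStep (R ω).G (R ω).o x else 0) = (R ⁻¹' T).indicator 1 ω := by
    filter_upwards [hinf] with ω hω
    have hm : ∀ x, (⟦(R ω).withSecond x⟧ : BirootedClass) ∈ S ↔ ω ∈ R ⁻¹' T := fun x => hmem _
    by_cases hT' : ω ∈ R ⁻¹' T
    · simp only [hm, if_pos hT', Set.indicator_of_mem hT']
      exact tsum_srwStep (degree_pos (R ω).connected _)
    · simp only [hm, if_neg hT', Set.indicator_of_notMem hT', tsum_zero]
  have e2 : ∀ ω, (∑' x, if (⟦(R ω).withFirst x⟧ : BirootedClass) ∈ S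
      then srwStep (R ω).G (R ω).o x else 0) = rerootMeasure (R ω) T := by
    intro ω
    rw [← lintegral_indicator_one hT, lintegral_rerootMeasure _ (measurable_one.indicator hT)]
    refine tsum_congr fun x => ?_
    have hm : (⟦(R ω).withFirst x⟧ : BirootedClass) ∈ S ↔ (R ω).reroot x ∈ T := hmem _
    by_cases hT' : (R ω).reroot x ∈ T
    · rw [if_pos (hm.2 hT'), Set.indicator_of_mem hT', Pi.one_apply, mul_one]
    · rw [if_neg (mt hm.1 hT'), Set.indicator_of_notMem hT', mul_zero]
  rw [lintegral_congr_ae e1, lintegral_indicator_one (hR.measurable hT)] at h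
  simp only [e2] at h
  exact h.symm

/-- The transition operator of the environment seen from the random walk. -/
def stepOp (f : RootedGraph → ℝ≥0∞) (R : RootedGraph) : ℝ≥0∞ := ∫⁻ R', f R' ∂(rerootMeasure R)

lemma measurable_stepOp_iterate {f : RootedGraph → ℝ≥0∞} (hf : Measurable f) (n : ℕ) :
    Measurable (stepOp^[n] f) := by
  induction n with
  | zero => exact hf
  | succ n ih =>
    rw [Function.iterate_succ_apply']
    exact measurable_lintegral_rerootMeasure ih

lemma IsReversible.lintegral_stepOp_iterate (hR : IsReversible P R)
    (hinf : ∀ᵐ ω ∂P, Infinite (R ω).V) {f : RootedGraph → ℝ≥0∞} (hf : Measurable f) (n : ℕ) :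
    ∫⁻ ω, stepOp^[n] f (R ω) ∂P = ∫⁻ ω, f (R ω) ∂P := by
  have hm := measurable_stepOp_iterate hf
  induction n with
  | zero => rfl
  | succ n ih =>
    rw [← ih, ← lintegral_map (hm _) hR.measurable, ← lintegral_map (hm _) hR.measurable]
    conv_rhs => rw [← hR.bind_rerootMeasure hinf]
    rw [Measure.lintegral_bind measurable_rerootMeasure.aemeasurable (hm n).aemeasurable]
    simp only [Function.iterate_succ_apply']
    rfl

/-- On a fixed graph the environment chain is the walk itself, so iterates become expectations along
simple random walk from `x`. -/
lemma stepOp_iterate_eq (R : RootedGraph) [Infinite R.V] {T : Set RootedGraph}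
    (hT : MeasurableSet T) (n : ℕ) (x : R.V) :
    stepOp^[n] (T.indicator 1) (R.reroot x) =
      ENNReal.ofReal ((avg R.G)^[n] ({y | R.reroot y ∈ T}.indicator 1) x) := by
  induction n generalizing x with
  | zero =>
    by_cases h : R.reroot x ∈ T
    · simp [h]
    · simp [h]
  | succ n ih =>
    have h0 := avg_iterate_nonneg (G := R.G) (f := {y | R.reroot y ∈ T}.indicator 1)
      (fun _ => Set.indicator_nonneg (fun _ _ => zero_le_one) _) n
    rw [Function.iterate_succ_apply', stepOp, lintegral_rerootMeasure _
      (measurable_stepOp_iterate (measurable_one.indicator hT) n), Function.iterate_succ_apply',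
      ← tsum_srwStep_mul_ofReal (degree_pos R.connected x) h0]
    refine tsum_congr fun y => ?_
    rw [← ih y]
    rfl

/-- A property of the root that holds at finitely many vertices only has probability zero. -/
lemma IsReversible.ae_notMem_of_finite [IsProbabilityMeasure P] (hR : IsReversible P R)
    (hinf : ∀ᵐ ω ∂P, Infinite (R ω).V) (hrec : ∀ᵐ ω ∂P, HitsAll (R ω).G)
    {T : Set RootedGraph} (hT : MeasurableSet T)
    (hfin : ∀ᵐ ω ∂P, {x | (R ω).reroot x ∈ T}.Finite) : ∀ᵐ ω ∂P, R ω ∉ T := by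
  set f : RootedGraph → ℝ≥0∞ := T.indicator 1 with hf
  have hfm : Measurable f := measurable_one.indicator hT
  set A : ℕ → Ω → ℝ≥0∞ := fun N ω => (N : ℝ≥0∞)⁻¹ * ∑ n ∈ Finset.range N, stepOp^[n] f (R ω)
    with hA
  have hm : ∀ n, Measurable fun ω => stepOp^[n] f (R ω) := fun n =>
    (measurable_stepOp_iterate hfm n).comp hR.measurable
  have hAm : ∀ N, Measurable (A N) := fun N =>
    (Finset.measurable_sum _ fun n _ => hm n).const_mul _
  have hAeq : ∀ᵐ ω ∂P, ∀ N, 0 < N → A N ω =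
      ENNReal.ofReal (timeAvg (R ω).G ({y | (R ω).reroot y ∈ T}.indicator 1) N (R ω).o) := by
    filter_upwards [hinf] with ω hω N hN
    simp only [hA]
    have : ∀ n, stepOp^[n] f (R ω) = _ := fun n => stepOp_iterate_eq (R ω) hT n (R ω).o
    simp only [this]
    rw [timeAvg, div_eq_inv_mul, ENNReal.ofReal_mul (by positivity), ENNReal.ofReal_inv_of_pos
      (by exact_mod_cast hN), ENNReal.ofReal_natCast, ENNReal.ofReal_sum_of_nonneg]
    exact fun n _ => avg_iterate_nonneg (fun _ => Set.indicator_nonneg (fun _ _ => zero_le_one) _)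
      n _
  -- For almost every graph the averages vanish by null recurrence, whereas by stationarity
  -- (`hconst`) their expectation is always the probability of `T`. The shift to `N + 1` avoids the
  -- empty average.
  have hlim : Tendsto (fun N => ∫⁻ ω, A (N + 1) ω ∂P) atTop (𝓝 (∫⁻ _, 0 ∂P)) := by
    refine tendsto_lintegral_of_dominated_convergence (fun _ => 1) (fun N => hAm _) (fun N => ?_)
      (by simp) ?_
    · filter_upwards [hAeq, hinf] with ω hω _
      rw [hω _ N.succ_pos, ← ENNReal.ofReal_one]
      exact ENNReal.ofReal_le_ofReal (timeAvg_le_one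
        (fun _ => Set.indicator_le_self' (fun _ _ => zero_le_one) _)
        (degree_pos (R ω).connected) _ _)
    · filter_upwards [hAeq, hinf, hrec, hfin] with ω hω _ hω2 hω3
      have h1 := tendsto_timeAvg_indicator hω2 (degree_pos (R ω).connected) hω3 (R ω).o
      have h2 := (ENNReal.tendsto_ofReal h1).comp (tendsto_add_atTop_nat 1)
      rw [ENNReal.ofReal_zero] at h2
      exact h2.congr fun N => (hω _ N.succ_pos).symm
  have hconst : ∀ N, ∫⁻ ω, A (N + 1) ω ∂P = P (R ⁻¹' T) := by
    intro N
    simp only [hA]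
    rw [lintegral_const_mul _ (Finset.measurable_sum _ fun n _ => hm n),
      lintegral_finsetSum _ fun n _ => hm n]
    simp only [hR.lintegral_stepOp_iterate hinf hfm]
    have h1 : ∫⁻ ω, f (R ω) ∂P = P (R ⁻¹' T) := by
      rw [← lintegral_indicator_one (hR.measurable hT)]
      rfl
    rw [Finset.sum_const, Finset.card_range, nsmul_eq_mul, h1, ← mul_assoc,
      ENNReal.inv_mul_cancel (by simp) (ENNReal.natCast_ne_top _), one_mul]
  simp only [hconst, lintegral_zero] at hlim
  have h0 : P (R ⁻¹' T) = 0 := tendsto_nhds_unique tendsto_const_nhds hlim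
  refine measure_mono_null ?_ h0
  intro ω hω
  exact not_not.1 hω

end Stationary

/-! ### Comparing the potential kernel in both directions -/

section Sphere

variable {V : Type} {G : SimpleGraph V} [G.LocallyFinite] [Infinite V]

/-- Balls are finite, so there are vertices beyond any radius, and a geodesic back to `o` crosses
every sphere. This makes spheres admissible as killing sets. -/
lemma exists_dist_eq (hc : G.Connected) (o : V) (r : ℕ) : ∃ v, G.dist o v = r := by
  have key : ∀ k v, G.dist o v = r + k → ∃ v, G.dist o v = r := by
    intro k
    induction k with
    | zero => exact fun v hv => ⟨v, hv⟩
    | succ k ih =>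
      intro v hv
      obtain ⟨p, hp⟩ := hc.exists_walk_length_eq_dist v o
      rw [SimpleGraph.dist_comm, hv] at hp
      cases p with
      | nil => simp at hp
      | @cons _ u _ hvu q =>
        simp only [SimpleGraph.Walk.length_cons] at hp
        have h1 : G.dist o u ≤ r + k := by
          rw [SimpleGraph.dist_comm]
          exact (SimpleGraph.dist_le q).trans (by omega)
        have h2 : G.dist o v ≤ G.dist o u + G.dist u v := hc.dist_triangle
        have h3 : G.dist u v = 1 := SimpleGraph.dist_eq_one_iff_adj.2 hvu.symm
        exact ih u (by omega)
  obtain ⟨v, hv⟩ := (finite_ball hc o r).infinite_compl.nonempty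
  have hv : ¬ G.dist o v ≤ r := hv
  exact key (G.dist o v - r) v (by omega)

variable [Countable V] [MeasurableSpace V] [DiscreteMeasurableSpace V] {a : V → V → ℝ} {o : V}

/-- The antisymmetric part of the potential kernel is the limit of differences of Green functions
on the diagonal. -/
lemma IsPotentialKernel.tendsto_sphere (h : IsPotentialKernel G o a) (hc : G.Connected)
    (p x y : V) :
    Tendsto (fun r : ℕ => greenFn G {v | G.dist p v = r} y y - greenFn G {v | G.dist p v = r} x x)
      atTop (𝓝 (a x y - a y x)) := by
  have hd := degree_pos hc
  have hfin : ∀ r : ℕ, {v | G.dist p v = r}.Finite := fun r =>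
    (finite_ball hc p r).subset fun v hv => le_of_eq hv
  have hne : ∀ r, (hfin r).toFinset.Nonempty := fun r => by
    obtain ⟨v, hv⟩ := exists_dist_eq hc p r
    exact ⟨v, by simpa using hv⟩
  have hinf : GoesToInfinity G p fun r => (hfin r).toFinset := by
    intro s
    filter_upwards [eventually_ge_atTop s] with r hr v hv
    have : G.dist p v = r := by simpa using hv
    omega
  have hp := h.reroot hc p
  have h1 := (hp _ hne hinf x y).sub (hp _ hne hinf y x)
  simp only [truncatedKernel_eq hd hc (hne _), Set.Finite.coe_toFinset] at h1
  refine h1.congr fun r => ?_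
  rw [greenFn_symm _ y x]
  ring

/-- The antisymmetric part of the potential kernel is a gradient. -/
lemma IsPotentialKernel.exists_gradient (h : IsPotentialKernel G o a) (hc : G.Connected) :
    ∃ β : V → ℝ, ∀ x y, a x y - a y x = β y - β x := by
  -- Differences of the diagonal values `g(y,y)` add up along any chain of vertices, and this
  -- survives in the limit.
  refine ⟨fun y => a o y - a y o, fun x y => ?_⟩
  refine tendsto_nhds_unique (h.tendsto_sphere hc o x y) ?_
  refine ((h.tendsto_sphere hc o o y).sub (h.tendsto_sphere hc o o x)).congr fun r => ?_
  ring

end Sphere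

/-! ### Domination of vertices as a measurable property -/

open Classical in
/-- The difference of the Green functions, killed at distance `r` from `o`, at `(ρ, ρ)` and
`(o, o)`. -/
def rootDiff (r : ℕ) (R : BirootedGraph) : ℝ :=
  if R.G.dist R.o R.ρ ≤ r then
    greenFn R.G {v | R.G.dist R.o v = r} R.ρ R.ρ - greenFn R.G {v | R.G.dist R.o v = r} R.o R.o
  else 0

/-- Inside the sphere of radius `r` the killed walk sees only a finite ball. The cutoff excludes
second roots outside it and disappears as `r` grows; the radius `m` is also large enough to decide
the cutoff. -/
lemma measurable_rootDiff (r : ℕ) : Measurable (rootDiff r) := by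
  refine BirootedGraph.measurable_of_ballIso fun R => ?_
  obtain ⟨m, hr, hρ⟩ : ∃ m, r + 1 ≤ m ∧ R.G.dist R.o R.ρ ≤ m :=
    ⟨_, le_max_left _ _, le_max_right _ _⟩
  refine ⟨m, ?_⟩
  rintro R' ⟨φ, h1, h2⟩
  have ho : R.G.dist R.o R.o ≤ m := by simp
  have ho' : (φ ⟨R.o, ho⟩ : R'.V) = R'.o := (h1 _).1 rfl
  have hρ' : (φ ⟨R.ρ, hρ⟩ : R'.V) = R'.ρ := (h2 _).1 rfl
  have hdist : R'.G.dist R'.o R'.ρ = R.G.dist R.o R.ρ :=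
    (congrArg (R'.G.dist R'.o) hρ').symm.trans
      (dist_root_map φ R.connected R'.connected h1 hρ)
  rw [rootDiff, rootDiff, hdist]
  split_ifs with h
  · have e1 : greenFn R'.G {v | R'.G.dist R'.o v = r} R'.ρ R'.ρ =
        greenFn R.G {v | R.G.dist R.o v = r} R.ρ R.ρ :=
      (congrArg (fun v => greenFn R'.G {v | R'.G.dist R'.o v = r} v v) hρ').symm.trans
        (greenFn_map φ R.connected R'.connected h1 hr h h)
    have e2 : greenFn R'.G {v | R'.G.dist R'.o v = r} R'.o R'.o =
        greenFn R.G {v | R.G.dist R.o v = r} R.o R.o :=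
      (congrArg (fun v => greenFn R'.G {v | R'.G.dist R'.o v = r} v v) ho').symm.trans
        (greenFn_map φ R.connected R'.connected h1 hr (by simp) (by simp))
    rw [e1, e2]
  · rfl

/-- The doubly rooted graphs with `a(o, ρ) ≤ a(ρ, o)`. -/
def dominated : Set BirootedGraph :=
  {R | ∀ k : ℕ, ∀ᶠ r in atTop, rootDiff r R ≤ 1 / ((k : ℝ) + 1)}

/-- The event is phrased through `rootDiff` and countable operations, so no measurable choice of `a`
is needed. -/
lemma measurableSet_dominated : MeasurableSet dominated := by
  have : dominated =
      ⋂ k : ℕ, ⋃ N : ℕ, ⋂ r : ℕ, ⋂ _ : N ≤ r, {R | rootDiff r R ≤ 1 / ((k : ℝ) + 1)} := by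
    ext R
    simp only [dominated, Set.mem_iInter, Set.mem_iUnion, Set.mem_ofPred_eq,
      Filter.eventually_atTop]
  rw [this]
  exact MeasurableSet.iInter fun k => MeasurableSet.iUnion fun N => MeasurableSet.iInter fun r =>
    MeasurableSet.iInter fun _ => measurableSet_le (measurable_rootDiff r) measurable_const

/-- The number of vertices `x` with `a(o, x) ≤ a(x, o)`. -/
def dominatedCount (R : RootedGraph) : ℝ≥0∞ := ∑' x, dominated.indicator 1 (R.withSecond x)

lemma measurable_dominatedCount : Measurable dominatedCount :=
  measurable_tsum_withSecond (measurable_one.indicator measurableSet_dominated)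

lemma mem_dominated_iff (R : RootedGraph) [Infinite R.V] {a : R.V → R.V → ℝ} {p : R.V}
    (ha : IsPotentialKernel R.G p a) (o x : R.V) :
    (R.reroot o).withSecond x ∈ dominated ↔ a o x ≤ a x o := by
  have h1 : Tendsto (fun r => rootDiff r ((R.reroot o).withSecond x)) atTop
      (𝓝 (a o x - a x o)) := by
    refine (ha.tendsto_sphere R.connected o o x).congr' ?_
    filter_upwards [eventually_ge_atTop (R.G.dist o x)] with r hr
    exact (if_pos hr).symm
  constructor
  · intro h
    have h2 : Tendsto (fun k : ℕ => 1 / ((k : ℝ) + 1)) atTop (𝓝 0) :=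
      tendsto_one_div_add_atTop_nhds_zero_nat
    have h3 : a o x - a x o ≤ 0 := ge_of_tendsto' h2 fun k => le_of_tendsto h1 (h k)
    linarith
  · intro h k
    have : a o x - a x o < 1 / ((k : ℝ) + 1) := by
      have : (0 : ℝ) < 1 / ((k : ℝ) + 1) := by positivity
      linarith
    exact (h1.eventually_lt_const this).mono fun r hr => hr.le

/-- With `β` as potential, domination means having the larger value. Among `k + 1` vertices of count
at most `k`, one with maximal `β` would dominate all `k + 1`. -/
lemma finite_dominatedCount_le (R : RootedGraph) [Infinite R.V] {a : R.V → R.V → ℝ} {p : R.V}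
    (ha : IsPotentialKernel R.G p a) (k : ℕ) :
    {x | dominatedCount (R.reroot x) ≤ k}.Finite := by
  obtain ⟨β, hβ⟩ := ha.exists_gradient R.connected
  by_contra hinf
  obtain ⟨t, ht, htk⟩ := Set.Infinite.exists_subset_card_eq hinf (k + 1)
  obtain ⟨x, hx, hmax⟩ := t.exists_max_image β (Finset.card_pos.1 (by omega))
  have h1 : dominatedCount (R.reroot x) ≤ k := ht hx
  have h2 : ((k + 1 : ℕ) : ℝ≥0∞) ≤ dominatedCount (R.reroot x) := by
    rw [← htk, ← nsmul_one, ← Finset.sum_const]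
    refine le_trans (Finset.sum_le_sum fun y hy => ?_) (ENNReal.sum_le_tsum t)
    have : (R.reroot x).withSecond y ∈ dominated := by
      rw [mem_dominated_iff R ha]
      have := hβ x y
      have := hmax y hy
      linarith
    rw [Set.indicator_of_mem this]
    exact le_rfl
  have h3 := h2.trans h1
  norm_cast at h3
  omega

lemma infinite_of_dominatedCount_eq_top (R : RootedGraph) [Infinite R.V] {a : R.V → R.V → ℝ}
    (ha : IsPotentialKernel R.G R.o a) (h : dominatedCount R = ∞) :
    {x | a R.o x ≤ a x R.o}.Infinite := by
  intro hfin
  refine ENNReal.natCast_ne_top hfin.toFinset.card ?_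
  rw [← h, dominatedCount, tsum_eq_sum (s := hfin.toFinset)]
  · rw [← nsmul_one, ← Finset.sum_const]
    refine Finset.sum_congr rfl fun x hx => ?_
    have : R.withSecond x ∈ dominated := (mem_dominated_iff R ha R.o x).2 (by simpa using hx)
    rw [Set.indicator_of_mem this, Pi.one_apply]
  · intro x hx
    have : R.withSecond x ∉ dominated :=
      fun h => hx (by simpa using (mem_dominated_iff R ha R.o x).1 h)
    rw [Set.indicator_of_notMem this]

end ReversibleGraph

end

/-! ### Conclusion -/

open ReversibleGraph
/-- For a reversible random graph `(G, o)` that is a.s. infinite, recurrent and with a well-defined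
potential kernel `a`, a.s. any two independent walks conditioned never to hit `o` (from any two
vertices from which this walk is defined) have traces with infinite intersection. -/
theorem proposition7p10 {Ω : Type*} [MeasurableSpace Ω] (P : Measure Ω) [IsProbabilityMeasure P]
    (R : Ω → RootedGraph) (hR : IsReversible P R)
    (hinf : ∀ᵐ ω ∂P, Infinite (R ω).V)
    (hrec : ∀ᵐ ω ∂P, Recurrent (R ω).G)
    (hker : ∀ᵐ ω ∂P, ∃ a, IsPotentialKernel (R ω).G (R ω).o a) :
    ∀ᵐ ω ∂P, ∀ a, IsPotentialKernel (R ω).G (R ω).o a →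
      ∀ x y : (R ω).V, (x = (R ω).o ∨ 0 < a x (R ω).o) → (y = (R ω).o ∨ 0 < a y (R ω).o) →
        ∀ᵐ ξ ∂((crwLaw (R ω).G (R ω).o a x).prod (crwLaw (R ω).G (R ω).o a y)),
          (Set.range ξ.1 ∩ Set.range ξ.2).Infinite := by
  have hall : ∀ᵐ ω ∂P, HitsAll (R ω).G := by
    filter_upwards [hinf, hrec] with ω hω h
    exact h.hitsAll (degree_pos (R ω).connected) (R ω).connected
  -- For each `k`, a count of at most `k` occurs at finitely many vertices only, hence almost surely
  -- not at the root. So the root has infinite count.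
  have hcount : ∀ᵐ ω ∂P, ∀ k : ℕ, R ω ∉ {g | dominatedCount g ≤ k} := by
    refine ae_all_iff.2 fun k => hR.ae_notMem_of_finite hinf hall
      (measurableSet_le measurable_dominatedCount measurable_const) ?_
    filter_upwards [hinf, hker] with ω hω ⟨a, ha⟩
    exact finite_dominatedCount_le (R ω) ha k
  filter_upwards [hinf, hall, hcount] with ω hω hω2 hω3 a ha x y hx hy
  refine crwLaw_ae_infinite_inter_range ha hω2 (degree_pos (R ω).connected) (R ω).connected
    (infinite_of_dominatedCount_eq_top (R ω) ha ?_) hx hy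
  by_contra hne
  obtain ⟨k, hk⟩ := ENNReal.exists_nat_gt hne
  exact hω3 k hk.le
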